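/- **Theorem (relative Sullivan theorem).** Let $M$ be a smooth (finite-dimensional, Hausdorff, second countable) manifold, possibly with boundary, let $Z\subset X\subset \operatorname{int}(M)$ be compact sets, and let $p\ge 0$. Let $\mathcal S_Z$ be a $p$-dimensional cone structure on $X$ relative to $Z$, that is, a family of compact convex cones $C_p(x)\subset\Lambda_pT_xM$ based at $0$, one for each $x\in X\setminus Z$, depending continuously on $x$ in the sense of Hausdorff convergence (in a chart) of the sets of unit $p$-vectors. Here a convex cone $C$ is compact if some continuous linear functional $L$ is positive on $C\setminus\{0\}$ and $C\cap L^{-1}(1)$ is compact. A smooth $p$-form $\lambda$ is *transversal relative to $Z$* if $\lambda(v)>0$ for all $x\in X\setminus Z$ and $0\neq v\in C_p(x)$, and $\lambda=0$ pointwise on $Z$. Let $\mathcal D^p$ be the space of compactly supported smooth $p$-forms on $M$ with the $C^\infty$-topology; a $p$-current is a continuous linear functional on $\mathcal D^p$. $H^p(M;\mathbb R)$ denotes de Rham cohomology (closed modulo exact smooth forms of arbitrary support; in degree $0$ only the zero form is exact). For an open neighborhood $U$ of $Z$ put $$\mathcal O_U=\{\alpha\in\mathcal D^p:\ \alpha(v)>0\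 \text{ for all } 0\ne v\in C_p(x),\ x\in X\setminus U\},$$ $$\mathcal A_{U,0}=\{\alpha\in\mathcal D^p:\ \alpha=0 \text{ on } Z,\ \alpha(v)\ge 0\ \text{ for all } v\in C_p(x),\ x\in \overline U\cap (X\setminus Z),\ d\alpha=0,\ [\alpha]=0\in H^p(M;\mathbb R)\}.$$ A *structure cycle relative to $U$* is a $p$-current $T$ with $T(\alpha)>0$ for all $\alpha\in\mathcal O_U$ and $T(\alpha)\le 0$ for all $\alpha\in\mathcal A_{U,0}$. Let $H_Z\subset H^p(M;\mathbb R)$ and $H_U\subset H^p(M;\mathbb R)$ be the subspaces of classes vanishing on some neighborhood of $Z$, respectively of $\overline U$. A structure cycle $T$ relative to $U$ induces $\mathcal T:H_U\to\mathbb R$, $\mathcal T(\xi)=T(\alpha)$, where $\alpha$ is any closed form representing $\xi$ that vanishes on a neighborhood of $\overline U$. (If $\alpha$ is not compactly supported, $T(\alpha)$ means $T(\gamma)$ for any $\gamma\in\mathcal D^p$ that agrees with $\alpha$ near $X$. The value does not depend on the choices.) Then, for every $\xi\in H_Z$, the class $\xi$ contains a closed form that is transversal relative to $Z$ if and only if $(*)$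 $\mathcal T(\xi)>0$ for every open neighborhood $U$ of $Z$ with $\xi\in H_U$ and every structure cycle $T$ relative to $U$. Moreover, if $\xi$ contains some compactly supported closed form (as is automatic when $M$ is compact), then $\xi$ contains a compactly supported closed form that is transversal relative to $Z$ if and only if $(*)$ holds. -/

import Mathlib

open Set Filter Topology
open scoped Manifold ContDiff

noncomputable section

namespace RelSullivan

/-! ### Compact convex cones -/

/-- A convex cone `C` based at `0` in a topological vector space is compact if some continuous
linear functional `L`, positive on `C \ {0}`, cuts out a compact base `C ∩ L⁻¹(1)`. -/
def IsCompactCone {V : Type*} [TopologicalSpace V] [AddCommGroup V] [Module ℝ V]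
    (C : PointedCone ℝ V) : Prop :=
  ∃ L : V →L[ℝ] ℝ, (∀ v ∈ C, v ≠ 0 → 0 < L v) ∧ IsCompact {v | v ∈ C ∧ L v = 1}

/-- The value `a(v)` of an alternating `p`-form `a` on a `p`-vector `v ∈ Λ_p V`. -/
def evalPVector {V : Type*} [TopologicalSpace V] [AddCommGroup V] [Module ℝ V] {p : ℕ}
    (a : V [⋀^Fin p]→L[ℝ] ℝ) (v : ⋀[ℝ]^p V) : ℝ :=
  exteriorPower.alternatingMapLinearEquiv a.toAlternatingMap v

section Manifold

variable {E : Type*} [NormedAddCommGroup E] [InnerProductSpace ℝ E]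
  {H : Type*} [TopologicalSpace H] (I : ModelWithCorners ℝ E H)
  {M : Type*} [TopologicalSpace M] [ChartedSpace H M]

/-! ### Differential forms on a manifold (possibly with boundary) -/

variable (M) in
/-- Arbitrary (not necessarily smooth) `p`-forms on `M`. -/
def FormField (p : ℕ) : Type _ := ∀ x : M, TangentSpace I x [⋀^Fin p]→L[ℝ] ℝ

instance (p : ℕ) : AddCommGroup (FormField I M p) :=
  inferInstanceAs (AddCommGroup (∀ x : M, TangentSpace I x [⋀^Fin p]→L[ℝ] ℝ))

instance (p : ℕ) : Module ℝ (FormField I M p) :=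
  inferInstanceAs (Module ℝ (∀ x : M, TangentSpace I x [⋀^Fin p]→L[ℝ] ℝ))

variable {I} in
/-- The expression of a `p`-form in the chart around `x₀`, i.e. its pullback under the inverse of
the chart; it is meaningful on the target of the chart. -/
def chartRep {p : ℕ} (x₀ : M) (α : FormField I M p) (y : E) : E [⋀^Fin p]→L[ℝ] ℝ :=
  (α ((extChartAt I x₀).symm y)).compContinuousLinearMap
    (mfderivWithin 𝓘(ℝ, E) I (extChartAt I x₀).symm (range I) y : E →L[ℝ] TangentSpace I _)

variable {I} in
/-- The form `α` is smooth (up to the boundary) on the open set `W`. -/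
def SmoothFormOn {p : ℕ} (α : FormField I M p) (W : Set M) : Prop :=
  ∀ x₀ : M, ContDiffOn ℝ ∞ (chartRep x₀ α)
    ((extChartAt I x₀).target ∩ (extChartAt I x₀).symm ⁻¹' W)

variable {I} in
/-- The exterior derivative; at `x` it is computed in the chart around `x`. -/
def extD {p : ℕ} (α : FormField I M p) : FormField I M (p + 1) := fun x =>
  (extDerivWithin (chartRep x α) (range I) (extChartAt I x x)).compContinuousLinearMap
    (mfderiv I 𝓘(ℝ, E) (extChartAt I x) x : TangentSpace I x →L[ℝ] E)

variable {I} in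
/-- The form `α` is exact on the open set `W`: it is `dβ` there, with `β` smooth on `W`. A `0`-form
is exact only if it is zero. -/
def ExactOn : {p : ℕ} → FormField I M p → Set M → Prop
  | 0, α, W => ∀ x ∈ W, α x = 0
  | p + 1, α, W => ∃ β : FormField I M p, SmoothFormOn β W ∧ ∀ x ∈ W, α x = extD β x

variable {I} in
theorem chartRep_add {p : ℕ} (x₀ : M) (α β : FormField I M p) :
    chartRep x₀ (α + β) = chartRep x₀ α + chartRep x₀ β := by
  funext y; ext v; rfl

variable {I} in
theorem chartRep_smul {p : ℕ} (x₀ : M) (c : ℝ) (α : FormField I M p) :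
    chartRep x₀ (c • α) = c • chartRep x₀ α := by
  funext y; ext v; rfl

variable {I} in
theorem chartRep_zero {p : ℕ} (x₀ : M) :
    chartRep x₀ (0 : FormField I M p) = 0 := by
  funext y; ext v; rfl

variable {I} in
theorem SmoothFormOn.zero {p : ℕ} (W : Set M) : SmoothFormOn (0 : FormField I M p) W := by
  intro x₀
  rw [chartRep_zero]; exact contDiffOn_const

variable {I} in
theorem SmoothFormOn.add {p : ℕ} {α β : FormField I M p} {W : Set M} (hα : SmoothFormOn α W)
    (hβ : SmoothFormOn β W) : SmoothFormOn (α + β) W := by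
  intro x₀
  rw [chartRep_add]; exact (hα x₀).add (hβ x₀)

variable {I} in
theorem SmoothFormOn.smul {p : ℕ} {α : FormField I M p} {W : Set M} (c : ℝ)
    (hα : SmoothFormOn α W) : SmoothFormOn (c • α) W := by
  intro x₀
  rw [chartRep_smul]; exact (hα x₀).const_smul c

variable {I} in
theorem SmoothFormOn.differentiableWithinAt {p : ℕ} {α : FormField I M p}
    (hα : SmoothFormOn α univ) (x : M) :
    DifferentiableWithinAt ℝ (chartRep x α) (range I) (extChartAt I x x) := by
  have h := hα x
  rw [preimage_univ, inter_univ] at h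
  exact ((h.contDiffWithinAt (mem_extChartAt_target x)).differentiableWithinAt
    (by simp)).mono_of_mem_nhdsWithin (extChartAt_target_mem_nhdsWithin x)

variable {I} in
theorem extD_zero {p : ℕ} : extD (0 : FormField I M p) = 0 := by
  funext x
  have hu : UniqueDiffWithinAt ℝ (range I) (extChartAt I x x) :=
    I.uniqueDiffOn _ (mem_range_self _)
  have h := extDerivWithin_smul (𝕜 := ℝ) 0 (chartRep x (0 : FormField I M p)) hu
  simp only [zero_smul] at h
  simp only [extD, chartRep_zero] at h ⊢
  rw [h]; rfl

variable {I} in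
theorem extD_add {p : ℕ} {α β : FormField I M p} (hα : SmoothFormOn α univ)
    (hβ : SmoothFormOn β univ) : extD (α + β) = extD α + extD β := by
  funext x
  have hu : UniqueDiffWithinAt ℝ (range I) (extChartAt I x x) :=
    I.uniqueDiffOn _ (mem_range_self _)
  change extD (α + β) x = extD α x + extD β x
  simp only [extD, chartRep_add]
  rw [extDerivWithin_add hu (hα.differentiableWithinAt x) (hβ.differentiableWithinAt x)]
  rfl

variable {I} in
theorem extD_smul {p : ℕ} (c : ℝ) (α : FormField I M p) : extD (c • α) = c • extD α := by
  funext x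
  have hu : UniqueDiffWithinAt ℝ (range I) (extChartAt I x x) :=
    I.uniqueDiffOn _ (mem_range_self _)
  change extD (c • α) x = c • extD α x
  simp only [extD, chartRep_smul]
  rw [extDerivWithin_smul c _ hu]
  rfl

variable (M) in
/-- Closed smooth `p`-forms. -/
def closedForms (p : ℕ) : Submodule ℝ (FormField I M p) where
  carrier := {α | SmoothFormOn α univ ∧ extD α = 0}
  add_mem' {α β} hα hβ :=
    ⟨hα.1.add hβ.1, by rw [extD_add hα.1 hβ.1, hα.2, hβ.2, add_zero]⟩
  zero_mem' := ⟨SmoothFormOn.zero _, extD_zero⟩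
  smul_mem' c α hα := ⟨hα.1.smul c, by rw [extD_smul, hα.2, smul_zero]⟩

variable (M) in
/-- Exact `p`-forms. -/
def exactForms (p : ℕ) : Submodule ℝ (FormField I M p) where
  carrier := {α | ExactOn α univ}
  add_mem' {α β} hα hβ := by
    cases p with
    | zero =>
      intro x hx
      change α x + β x = 0
      rw [hα x hx, hβ x hx, add_zero]
    | succ p =>
      obtain ⟨a, ha, ha'⟩ := hα
      obtain ⟨b, hb, hb'⟩ := hβ
      refine ⟨a + b, ha.add hb, fun x hx => ?_⟩
      rw [extD_add ha hb]
      change α x + β x = extD a x + extD b x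
      rw [ha' x hx, hb' x hx]
  zero_mem' := by
    cases p with
    | zero => intro x _; rfl
    | succ p => exact ⟨0, SmoothFormOn.zero _, fun x _ => by rw [extD_zero]⟩
  smul_mem' c α hα := by
    cases p with
    | zero =>
      intro x hx
      change c • α x = 0
      rw [hα x hx, smul_zero]
    | succ p =>
      obtain ⟨a, ha, ha'⟩ := hα
      refine ⟨c • a, ha.smul c, fun x hx => ?_⟩
      rw [extD_smul]
      change c • α x = c • extD a x
      rw [ha' x hx]

variable (M) in
/-- The de Rham cohomology `H^p(M; ℝ)`: closed forms modulo exact forms. -/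
abbrev DeRham (p : ℕ) : Type _ :=
  closedForms I M p ⧸ (exactForms I M p).comap (closedForms I M p).subtype

variable {I} in
/-- `α` is a closed smooth form representing (contained in) the class `ξ`. -/
def Represents {p : ℕ} (α : FormField I M p) (ξ : DeRham I M p) : Prop :=
  ∃ a : closedForms I M p, (a : FormField I M p) = α ∧ Submodule.Quotient.mk a = ξ

/-- For a set `A`, the set of classes in `H^p(M; ℝ)` that vanish on some open neighborhood
of `A`. -/
def classesVanishingNear (p : ℕ) (A : Set M) : Set (DeRham I M p) :=
  {ξ | ∃ α : FormField I M p, Represents α ξ ∧ ∃ W : Set M, IsOpen W ∧ A ⊆ W ∧ ExactOn α W}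

/-! ### Compactly supported forms and currents -/

variable {I} in
/-- The support of a form. -/
def formSupport {p : ℕ} (α : FormField I M p) : Set M := closure {x | α x ≠ 0}

variable (M) in
/-- The space `𝓓^p` of compactly supported smooth `p`-forms. -/
def testForms (p : ℕ) : Submodule ℝ (FormField I M p) where
  carrier := {α | SmoothFormOn α univ ∧ IsCompact (formSupport α)}
  add_mem' {α β} hα hβ := by
    refine ⟨hα.1.add hβ.1, (hα.2.union hβ.2).of_isClosed_subset isClosed_closure
      (closure_minimal ?_ (isClosed_closure.union isClosed_closure))⟩
    intro x hx
    by_contra hn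
    have h1 : α x = 0 := by
      by_contra h; exact hn (Or.inl (subset_closure h))
    have h2 : β x = 0 := by
      by_contra h; exact hn (Or.inr (subset_closure h))
    exact hx (show α x + β x = 0 by rw [h1, h2, add_zero])
  zero_mem' := ⟨SmoothFormOn.zero _, isCompact_empty.of_isClosed_subset isClosed_closure
    (closure_minimal (fun _ hx => (hx rfl).elim) isClosed_empty)⟩
  smul_mem' c α hα := by
    refine ⟨hα.1.smul c, hα.2.of_isClosed_subset isClosed_closure
      (closure_minimal ?_ isClosed_closure)⟩
    intro x hx
    by_contra hn
    have h1 : α x = 0 := by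
      by_contra h; exact hn (subset_closure h)
    exact hx (show c • α x = 0 by rw [h1, smul_zero])

/-- Continuity of a linear functional on `𝓓^p` in the `C^∞`-topology: over every compact subset of
a chart domain, `|T α|` is bounded by a constant times the supremum of finitely many derivatives of
the chart expression of `α`. -/
def IsCurrent {p : ℕ} (T : testForms I M p →ₗ[ℝ] ℝ) : Prop :=
  ∀ (x₀ : M) (K : Set M), IsCompact K → K ⊆ (chartAt H x₀).source →
    ∃ (N : ℕ) (C : ℝ), ∀ α : testForms I M p, formSupport α.1 ⊆ K → ∀ B : ℝ, 0 ≤ B →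
      (∀ k ≤ N, ∀ x ∈ K,
        ‖iteratedFDerivWithin ℝ k (chartRep x₀ α.1) (range I) (extChartAt I x₀ x)‖ ≤ B) →
      |T α| ≤ C * B

variable (M) in
/-- The space `𝓓_p` of `p`-dimensional currents: continuous linear functionals on `𝓓^p`. -/
structure Current (p : ℕ) where
  /-- the underlying linear functional -/
  toLinearMap : testForms I M p →ₗ[ℝ] ℝ
  isCurrent : IsCurrent I toLinearMap

/-! ### Relative cone structures -/

variable {I} in
/-- The image in `Λ_p E` of a cone `C ⊆ Λ_p T_y M` under the differential of the chart around
`x₀`. -/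
def coneInChart {p : ℕ} (x₀ y : M) (C : PointedCone ℝ (⋀[ℝ]^p (TangentSpace I y))) :
    PointedCone ℝ (⋀[ℝ]^p E) :=
  C.map (exteriorPower.map p
    (mfderiv I 𝓘(ℝ, E) (extChartAt I x₀) y : TangentSpace I y →L[ℝ] E).toLinearMap)

/-- A `p`-dimensional cone structure on `X` relative to `Z`: compact convex cones
`C_p(x) ⊆ Λ_p T_x M` for `x ∈ X \ Z` (the values of `cone` elsewhere are irrelevant) depending
continuously on `x`, in the sense of Hausdorff convergence, in a chart, of the sets of unit
`p`-vectors. -/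
structure RelConeStructure [FiniteDimensional ℝ E] (p : ℕ) (X Z : Set M) where
  /-- the cone at a point -/
  cone : ∀ x : M, PointedCone ℝ (⋀[ℝ]^p (TangentSpace I x))
  isCompactCone : ∀ x ∈ X \ Z, IsCompactCone (coneInChart x x (cone x))
  continuous_cone : ∀ x₀ ∈ X \ Z,
    Tendsto (fun y => Metric.hausdorffEDist
      {w : ⋀[ℝ]^p E | w ∈ coneInChart x₀ y (cone y) ∧ ‖w‖ = 1}
      {w : ⋀[ℝ]^p E | w ∈ coneInChart x₀ x₀ (cone x₀) ∧ ‖w‖ = 1}) (𝓝[X \ Z] x₀) (𝓝 0)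

variable {I}
variable [FiniteDimensional ℝ E] {p : ℕ} {X Z : Set M}

/-- `α` is positive on the nonzero vectors of the cones over `A`. -/
def RelConeStructure.PosOn (S : RelConeStructure I p X Z) (α : FormField I M p) (A : Set M) :
    Prop :=
  ∀ x ∈ A ∩ (X \ Z), ∀ v ∈ S.cone x, v ≠ 0 → 0 < evalPVector (α x) v

/-- `α` is nonnegative on the cones over `A`. -/
def RelConeStructure.NonnegOn (S : RelConeStructure I p X Z) (α : FormField I M p) (A : Set M) :
    Prop :=
  ∀ x ∈ A ∩ (X \ Z), ∀ v ∈ S.cone x, 0 ≤ evalPVector (α x) v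

/-- Transversality relative to `Z`: positivity on the cones over `X \ Z`, and pointwise vanishing
on `Z`. -/
def RelConeStructure.IsTransversal (S : RelConeStructure I p X Z) (α : FormField I M p) : Prop :=
  S.PosOn α univ ∧ ∀ x ∈ Z, α x = 0

/-- The open cone `𝓞_U ⊆ 𝓓^p`. -/
def RelConeStructure.openCone (S : RelConeStructure I p X Z) (U : Set M) :
    Set (testForms I M p) :=
  {α | S.PosOn α.1 Uᶜ}

/-- The closed cone `𝓐_{U,ξ} ⊆ 𝓓^p`. -/
def RelConeStructure.closedCone (S : RelConeStructure I p X Z) (U : Set M) (ξ : DeRham I M p) :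
    Set (testForms I M p) :=
  {α | (∀ x ∈ Z, α.1 x = 0) ∧ S.NonnegOn α.1 (closure U) ∧ Represents α.1 ξ}

/-- Structure currents relative to `U`. -/
def RelConeStructure.IsStructureCurrent (S : RelConeStructure I p X Z) (U : Set M)
    (T : Current I M p) : Prop :=
  ∀ α ∈ S.openCone U, 0 < T.toLinearMap α

/-- Structure cycles relative to `U`. -/
def RelConeStructure.IsStructureCycle (S : RelConeStructure I p X Z) (U : Set M)
    (T : Current I M p) : Prop :=
  S.IsStructureCurrent U T ∧ ∀ α ∈ S.closedCone U 0, T.toLinearMap α ≤ 0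

/-- `γ ∈ 𝓓^p` agrees near `X` with a closed form that represents `ξ` and vanishes on some
neighborhood of the closure of `U`. -/
def IsTestRepresentative (X U : Set M) (ξ : DeRham I M p) (γ : testForms I M p) : Prop :=
  ∃ α : FormField I M p, Represents α ξ ∧ (∀ᶠ x in 𝓝ˢ (closure U), α x = 0) ∧
    ∀ᶠ x in 𝓝ˢ X, γ.1 x = α x

/-- `t` is the value at `ξ ∈ H_U` of the homomorphism induced by a structure cycle `T` relative
to `U`: the value of `T` on any representative of `ξ` that vanishes near the closure of `U`. The
representative need not have compact support; since `T` is supported in the compact set `X`, it is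
evaluated on a compactly supported form that agrees with the representative near `X`. -/
def IsInducedValue (X U : Set M) (T : Current I M p) (ξ : DeRham I M p) (t : ℝ) : Prop :=
  (∃ γ, IsTestRepresentative X U ξ γ) ∧
    ∀ γ, IsTestRepresentative X U ξ γ → T.toLinearMap γ = t

/-- The induced homomorphism of every structure cycle relative to every open neighborhood `U` of
`Z` with `ξ ∈ H_U` is positive on `ξ`. -/
def RelConeStructure.PositiveOnCycles (S : RelConeStructure I p X Z) (ξ : DeRham I M p) : Prop :=
  ∀ U : Set M, IsOpen U → Z ⊆ U → ξ ∈ classesVanishingNear I p (closure U) →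
    ∀ T : Current I M p, S.IsStructureCycle U T → ∃ t, IsInducedValue X U T ξ t ∧ 0 < t

end Manifold

end RelSullivan

end

noncomputable section

namespace RelSullivan

/-! ### Alternating forms on a finite-dimensional space -/

section Linear

variable {E : Type*} [NormedAddCommGroup E] [InnerProductSpace ℝ E] [FiniteDimensional ℝ E] {p : ℕ}

/-! Suppose first that `ξ` contains a transversal form `λ`, let `T` be a structure cycle relative to
`U`, and let `α` represent `ξ` and vanish near `closure U`. The difference `λ - α` is exact,
vanishes on `Z` and is nonnegative on the cones over `closure U`, so, cut off away from `X`, it lies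
in `𝓐_{U,0}` and `T(λ) ≤ T(α)`. Since `λ` is positive off `U`, `0 < T(λ)`. The same comparison for
two forms vanishing near `closure U` gives both inequalities, which is why the induced value is well
defined (`IsStructureCycle.le_of_isTestRepresentative`). Values off `X` do not matter, because a
structure current kills every form that vanishes on `X`.

For the converse, represent `ξ` by a form `α` vanishing near `Z`, and choose neighborhoods `U i` of
`Z` with intersection `Z`, each with closure inside the region where `α = 0`. If no element of `α +
𝓐_{U i,0}` were positive off `U i`, a Hahn–Banach argument would give a structure cycle with `T(α) ≤
0`, against the hypothesis (`exists_structureCycle`). The functional comes from the Riesz extension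
theorem. Its continuity is automatic: on the compact set `X \ U i`, off `Z`, a positive form
dominates every other form, so a positive functional has order zero.

This yields exact forms `a i`, zero on `Z`, with `α + a i` nonnegative on all cones and positive off
`U i`. A weighted average of the `α + a i` is transversal (`exists_transversal_add`). To keep the
average exact relative to `α`, the series is formed from primitives of the `a i`, cut off to the
interior of `M`, with weights decaying fast enough for smooth convergence (`exists_form_series`).
Thus no closedness of the space of exact forms is needed. All corrections can be made compactly
supported, which gives the last assertion. -/

instance finiteDimensional_continuousAlternatingMap :
    FiniteDimensional ℝ (E [⋀^Fin p]→L[ℝ] ℝ) := by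
  have : FiniteDimensional ℝ (E [⋀^Fin p]→ₗ[ℝ] ℝ) :=
    LinearEquiv.finiteDimensional
      (exteriorPower.alternatingMapLinearEquiv (R := ℝ) (M := E) (N := ℝ) (n := p)).symm
  refine FiniteDimensional.of_injective
    (ContinuousAlternatingMap.toAlternatingMapLinear (R := ℝ) (A := ℝ) (M := E) (N := ℝ)
      (ι := Fin p)) ?_
  exact ContinuousAlternatingMap.toAlternatingMap_injective

/-- A map into alternating forms is smooth as soon as all its evaluations are. -/
theorem contDiffWithinAt_alternating_of_apply {G : Type*} [NormedAddCommGroup G] [NormedSpace ℝ G]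
    {n : WithTop ℕ∞} {f : G → E [⋀^Fin p]→L[ℝ] ℝ} {s : Set G} {x : G}
    (h : ∀ v : Fin p → E, ContDiffWithinAt ℝ n (fun y => f y v) s x) :
    ContDiffWithinAt ℝ n f s x := by
  let b := Module.finBasis ℝ E
  -- `Φ` records the values on tuples of basis vectors. It is injective, so a linear left inverse
  -- recovers `f` from finitely many scalar functions.
  let Φ : (E [⋀^Fin p]→L[ℝ] ℝ) →ₗ[ℝ] ((Fin p → Fin (Module.finrank ℝ E)) → ℝ) :=
    { toFun := fun a J => a fun j => b (J j)
      map_add' := fun _ _ => rfl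
      map_smul' := fun _ _ => rfl }
  have hΦ : Function.Injective Φ := by
    intro a a' h
    apply ContinuousAlternatingMap.toAlternatingMap_injective
    refine b.ext_alternating fun J _ => congrFun h J
  obtain ⟨Ψ, hΨ⟩ := Φ.exists_leftInverse_of_injective (LinearMap.ker_eq_bot.2 hΦ)
  have h1 : f = fun y => Ψ.toContinuousLinearMap (Φ (f y)) := by
    funext y; exact (LinearMap.congr_fun hΨ (f y)).symm
  rw [h1]
  refine Ψ.toContinuousLinearMap.contDiff.contDiffAt.comp_contDiffWithinAt x ?_
  exact contDiffWithinAt_pi.2 fun J => h _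

/-- Pullback is linear in the form and multilinear in the copies of the linear map inserted in the
`p` slots, hence smooth in both. -/
theorem contDiffWithinAt_compContinuousLinearMap {G F : Type*} [NormedAddCommGroup G]
    [NormedSpace ℝ G] [NormedAddCommGroup F] [NormedSpace ℝ F] {n : WithTop ℕ∞}
    {f : G → F [⋀^Fin p]→L[ℝ] ℝ} {g : G → E →L[ℝ] F} {s : Set G} {x : G}
    (hf : ContDiffWithinAt ℝ n f s x) (hg : ContDiffWithinAt ℝ n g s x) :
    ContDiffWithinAt ℝ n (fun y => (f y).compContinuousLinearMap (g y)) s x := by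
  refine contDiffWithinAt_alternating_of_apply fun v => ?_
  have h1 : ContDiffWithinAt ℝ n (fun y =>
      ContinuousMultilinearMap.compContinuousLinearMapContinuousMultilinear ℝ
        (fun _ : Fin p => E) (fun _ : Fin p => F) ℝ fun _ => g y) s x :=
    ContDiffAt.comp_contDiffWithinAt
      (g := fun h : Fin p → E →L[ℝ] F =>
        ContinuousMultilinearMap.compContinuousLinearMapContinuousMultilinear ℝ
          (fun _ : Fin p => E) (fun _ : Fin p => F) ℝ h) x
      (by
        apply ContDiff.contDiffAt
        apply ContinuousMultilinearMap.contDiff) (contDiffWithinAt_pi.2 fun _ => hg)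
  have h2 : ContDiffWithinAt ℝ n (fun y => (f y).toContinuousMultilinearMap) s x :=
    (ContinuousAlternatingMap.toContinuousMultilinearMapLI (𝕜 := ℝ) (E := F) (F := ℝ)
      (ι := Fin p)).contDiff.contDiffAt.comp_contDiffWithinAt x hf
  exact (ContinuousMultilinearMap.apply ℝ (fun _ : Fin p => E) ℝ
    v).contDiff.contDiffAt.comp_contDiffWithinAt x (h1.clm_apply h2)

/-- Every linear functional on `Λ_p E` is the evaluation of a form. -/
theorem exists_evalPVector_eq (L : ⋀[ℝ]^p E →ₗ[ℝ] ℝ) :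
    ∃ a : E [⋀^Fin p]→L[ℝ] ℝ, ∀ v, evalPVector a v = L v := by
  let f := exteriorPower.alternatingMapLinearEquiv.symm L
  -- Expanding each argument in a basis shows that `f` is a polynomial in the coordinates.
  have hf : Continuous f := by
    let b := Module.finBasis ℝ E
    have h : ∀ m, f m = ∑ J : Fin p → Fin (Module.finrank ℝ E),
        (∏ j, b.repr (m j) (J j)) * f fun j => b (J j) := by
      intro m
      have h1 : m = fun j => ∑ i, b.repr (m j) i • b i := by
        funext j; exact (b.sum_repr (m j)).symm
      conv_lhs => rw [h1]
      rw [← AlternatingMap.coe_multilinearMap, MultilinearMap.map_sum]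
      refine Finset.sum_congr rfl fun J _ => ?_
      rw [MultilinearMap.map_smul_univ, smul_eq_mul]
    have h' : (f : (Fin p → E) → ℝ) = fun m => ∑ J : Fin p → Fin (Module.finrank ℝ E),
        (∏ j, b.repr (m j) (J j)) * f fun j => b (J j) := funext h
    rw [h']
    refine continuous_finsetSum _ fun J _ => Continuous.mul (continuous_finsetProd _ fun j _ => ?_)
      continuous_const
    exact ((b.coord (J j)).continuous_of_finiteDimensional).comp (continuous_apply j)
  refine ⟨{ toMultilinearMap := f.toMultilinearMap, cont := hf, map_eq_zero_of_eq' :=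
    f.map_eq_zero_of_eq' }, fun v => ?_⟩
  exact LinearMap.congr_fun (exteriorPower.alternatingMapLinearEquiv.apply_symm_apply L) v

/-- The evaluation of forms on `p`-vectors is bounded. -/
theorem exists_evalPVector_bound (E : Type*) [NormedAddCommGroup E] [InnerProductSpace ℝ E]
    [FiniteDimensional ℝ E] (p : ℕ) :
    ∃ C : ℝ, 0 < C ∧ ∀ (a : E [⋀^Fin p]→L[ℝ] ℝ) (w : ⋀[ℝ]^p E),
      |evalPVector a w| ≤ C * ‖a‖ * ‖w‖ := by
  let b := Module.finBasis ℝ (⋀[ℝ]^p E)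
  let e : Fin (Module.finrank ℝ (⋀[ℝ]^p E)) → (E [⋀^Fin p]→L[ℝ] ℝ) →L[ℝ] ℝ := fun i =>
    LinearMap.toContinuousLinearMap
      { toFun := fun a => evalPVector a (b i)
        map_add' := fun a a' => by simp [evalPVector]
        map_smul' := fun c a => by simp [evalPVector] }
  let c : Fin (Module.finrank ℝ (⋀[ℝ]^p E)) → ⋀[ℝ]^p E →L[ℝ] ℝ := fun i =>
    LinearMap.toContinuousLinearMap (b.coord i)
  refine ⟨∑ i, ‖e i‖ * ‖c i‖ + 1, by positivity, fun a w => ?_⟩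
  have h1 : evalPVector a w = ∑ i, c i w * e i a := by
    conv_lhs => rw [← b.sum_repr w]
    unfold evalPVector
    rw [map_sum]
    refine Finset.sum_congr rfl fun i _ => ?_
    rw [map_smul, smul_eq_mul]
    rfl
  calc |evalPVector a w| ≤ ∑ i, |c i w * e i a| := by
        rw [h1]; exact Finset.abs_sum_le_sum_abs _ _
    _ ≤ ∑ i, ‖e i‖ * ‖c i‖ * (‖a‖ * ‖w‖) := by
        refine Finset.sum_le_sum fun i _ => ?_
        rw [abs_mul]
        have h2 : |c i w| ≤ ‖c i‖ * ‖w‖ := (c i).le_opNorm w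
        have h3 : |e i a| ≤ ‖e i‖ * ‖a‖ := (e i).le_opNorm a
        calc |c i w| * |e i a| ≤ (‖c i‖ * ‖w‖) * (‖e i‖ * ‖a‖) := by gcongr
          _ = _ := by ring
    _ = (∑ i, ‖e i‖ * ‖c i‖) * ‖a‖ * ‖w‖ := by rw [← Finset.sum_mul]; ring
    _ ≤ _ := by gcongr; linarith

end Linear

/-! ### Pairing of forms with `p`-vectors. -/

section Eval

variable {V W : Type*} [TopologicalSpace V] [AddCommGroup V] [Module ℝ V]
  [TopologicalSpace W] [AddCommGroup W] [Module ℝ W] {p : ℕ}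

theorem evalPVector_comp (a : W [⋀^Fin p]→L[ℝ] ℝ) (A : V →L[ℝ] W) (v : ⋀[ℝ]^p V) :
    evalPVector (a.compContinuousLinearMap A) v =
      evalPVector a (exteriorPower.map p A.toLinearMap v) := by
  unfold evalPVector
  rw [← LinearMap.comp_apply]
  congr 1
  ext m
  simp

theorem evalPVector_add (a b : V [⋀^Fin p]→L[ℝ] ℝ) (v : ⋀[ℝ]^p V) :
    evalPVector (a + b) v = evalPVector a v + evalPVector b v := by
  simp [evalPVector]

theorem evalPVector_zero (v : ⋀[ℝ]^p V) : evalPVector (0 : V [⋀^Fin p]→L[ℝ] ℝ) v = 0 := by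
  simp [evalPVector]

theorem evalPVector_smul (c : ℝ) (a : V [⋀^Fin p]→L[ℝ] ℝ) (v : ⋀[ℝ]^p V) :
    evalPVector (c • a) v = c * evalPVector a v := by
  simp [evalPVector]

theorem exteriorPower_map_injective_of_comp_eq_id {A : V →L[ℝ] W} {B : W →L[ℝ] V}
    (h : B ∘L A = ContinuousLinearMap.id ℝ V) :
    Function.Injective (exteriorPower.map p A.toLinearMap) :=
  exteriorPower.map_injective B.toLinearMap (by
    ext v; exact DFunLike.congr_fun h v)

end Eval

/-! ### Change of charts -/

section Charts

variable {E : Type*} [NormedAddCommGroup E] [InnerProductSpace ℝ E]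
  {H : Type*} [TopologicalSpace H] {I : ModelWithCorners ℝ E H}
  {M : Type*} [TopologicalSpace M] [ChartedSpace H M] {p : ℕ}

variable (I) in
/-- The transition map from the chart around `x₁` to the chart around `x₀`. -/
def transition (x₁ x₀ : M) : E → E := extChartAt I x₀ ∘ (extChartAt I x₁).symm

variable (I) in
/-- The differential at `x` of the chart around `x₀`. -/
def chartD (x₀ x : M) : TangentSpace I x →L[ℝ] E :=
  mfderiv I 𝓘(ℝ, E) (extChartAt I x₀) x

variable (I) in
/-- The differential at `y` of the inverse of the chart around `x₀`. -/
def chartSymmD (x₀ : M) (y : E) : E →L[ℝ] TangentSpace I ((extChartAt I x₀).symm y) :=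
  mfderivWithin 𝓘(ℝ, E) I (extChartAt I x₀).symm (range I) y

theorem chartRep_def (x₀ : M) (α : FormField I M p) (y : E) :
    chartRep x₀ α y =
      (α ((extChartAt I x₀).symm y)).compContinuousLinearMap (chartSymmD I x₀ y) := rfl

theorem chartRep_congr {α β : FormField I M p} {x₀ : M} {y : E}
    (h : α ((extChartAt I x₀).symm y) = β ((extChartAt I x₀).symm y)) :
    chartRep x₀ α y = chartRep x₀ β y := by
  rw [chartRep_def, chartRep_def, h]

theorem chartRep_eq_zero {α : FormField I M p} {x₀ : M} {y : E}
    (h : α ((extChartAt I x₀).symm y) = 0) : chartRep x₀ α y = 0 := by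
  rw [chartRep_def, h]; rfl

variable [IsManifold I ∞ M]

theorem isManifold_one (I : ModelWithCorners ℝ E H) (M : Type*) [TopologicalSpace M]
    [ChartedSpace H M] [IsManifold I ∞ M] : IsManifold I 1 M :=
  IsManifold.of_le (n := ∞) (by simp)

theorem chartSymmD_comp_chartD {x₀ : M} {y : E} (hy : y ∈ (extChartAt I x₀).target) :
    (chartSymmD I x₀ y) ∘L (chartD I x₀ ((extChartAt I x₀).symm y)) =
      ContinuousLinearMap.id ℝ _ := by
  have := isManifold_one I M
  exact mfderivWithin_extChartAt_symm_comp_mfderiv_extChartAt hy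

theorem chartD_comp_chartSymmD {x₀ : M} {y : E} (hy : y ∈ (extChartAt I x₀).target) :
    (chartD I x₀ ((extChartAt I x₀).symm y)) ∘L (chartSymmD I x₀ y) =
      ContinuousLinearMap.id ℝ _ := by
  have := isManifold_one I M
  exact mfderiv_extChartAt_comp_mfderivWithin_extChartAt_symm hy

theorem chartD_comp_chartSymmD_eq {x₁ x₀ : M} {y : E} (hy : y ∈ (extChartAt I x₁).target)
    (hy' : (extChartAt I x₁).symm y ∈ (extChartAt I x₀).source) :
    (chartD I x₀ ((extChartAt I x₁).symm y)) ∘L (chartSymmD I x₁ y) =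
      fderivWithin ℝ (transition I x₁ x₀) (range I) y := by
  have := isManifold_one I M
  have U : UniqueMDiffWithinAt 𝓘(ℝ, E) (range I) y :=
    I.uniqueMDiffOn _ (extChartAt_target_subset_range x₁ hy)
  rw [← mfderivWithin_eq_fderivWithin, transition,
    mfderiv_comp_mfderivWithin (I' := I) (g := extChartAt I x₀) (f := (extChartAt I x₁).symm) y
      (mdifferentiableAt_extChartAt (by rwa [← extChartAt_source (I := I)]))
      (mdifferentiableWithinAt_extChartAt_symm hy) U]
  rfl

omit [IsManifold I ∞ M] in
theorem exists_mem_target_eq {x₀ x : M} (hx : x ∈ (extChartAt I x₀).source) :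
    ∃ y ∈ (extChartAt I x₀).target, (extChartAt I x₀).symm y = x :=
  ⟨_, (extChartAt I x₀).map_source hx, (extChartAt I x₀).left_inv hx⟩

theorem form_eq_chartRep (α : FormField I M p) {x₀ x : M} (hx : x ∈ (extChartAt I x₀).source) :
    α x = (chartRep x₀ α (extChartAt I x₀ x)).compContinuousLinearMap (chartD I x₀ x) := by
  obtain ⟨y, hy, rfl⟩ := exists_mem_target_eq hx
  rw [(extChartAt I x₀).right_inv hy, chartRep_def]
  apply ContinuousAlternatingMap.ext
  intro v
  change _ = α ((extChartAt I x₀).symm y) _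
  congr 1
  funext i
  exact (DFunLike.congr_fun (chartSymmD_comp_chartD hy) (v i)).symm

/-- A form can be recovered from its expression in any chart, so two expressions differ by the
pullback under the transition map. Chart independence of smoothness and of the exterior derivative
rests on this. -/
theorem chartRep_change (α : FormField I M p) {x₁ x₀ : M} {y : E}
    (hy : y ∈ (extChartAt I x₁).target)
    (hy' : (extChartAt I x₁).symm y ∈ (extChartAt I x₀).source) :
    chartRep x₁ α y = (chartRep x₀ α (transition I x₁ x₀ y)).compContinuousLinearMap
      (fderivWithin ℝ (transition I x₁ x₀) (range I) y) := by
  rw [← chartD_comp_chartSymmD_eq hy hy', chartRep_def x₁, form_eq_chartRep α hy']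
  rfl

theorem evalPVector_eq_chartRep (α : FormField I M p) {x₀ x : M}
    (hx : x ∈ (extChartAt I x₀).source) (v : ⋀[ℝ]^p (TangentSpace I x)) :
    evalPVector (α x) v = evalPVector (chartRep x₀ α (extChartAt I x₀ x))
      (exteriorPower.map p (chartD I x₀ x).toLinearMap v) := by
  rw [← evalPVector_comp, ← form_eq_chartRep α hx]

omit [IsManifold I ∞ M] in
theorem mem_trans_source {x₁ x₀ : M} {y : E} (hy : y ∈ (extChartAt I x₁).target)
    (hy' : (extChartAt I x₁).symm y ∈ (extChartAt I x₀).source) :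
    y ∈ ((extChartAt I x₁).symm ≫ extChartAt I x₀).source := by
  rw [PartialEquiv.trans_source, PartialEquiv.symm_source]
  exact ⟨hy, hy'⟩

theorem contDiffWithinAt_transition {x₁ x₀ : M} {y : E} (hy : y ∈ (extChartAt I x₁).target)
    (hy' : (extChartAt I x₁).symm y ∈ (extChartAt I x₀).source) :
    ContDiffWithinAt ℝ ∞ (transition I x₁ x₀) (range I) y :=
  contDiffWithinAt_ext_coord_change x₀ x₁ (mem_trans_source hy hy')

theorem contDiffWithinAt_fderivWithin_transition {x₁ x₀ : M} {y : E}
    (hy : y ∈ (extChartAt I x₁).target)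
    (hy' : (extChartAt I x₁).symm y ∈ (extChartAt I x₀).source) :
    ContDiffWithinAt ℝ ∞ (fderivWithin ℝ (transition I x₁ x₀) (range I)) (range I) y :=
  (contDiffWithinAt_transition hy hy').fderivWithin_right I.uniqueDiffOn (by simp)
    (extChartAt_target_subset_range x₁ hy)

omit [IsManifold I ∞ M] in
/-- The points of the chart around `x₁` that are near `y` lie in a given neighborhood. -/
theorem eventually_target_and {x₁ : M} {y : E} (hy : y ∈ (extChartAt I x₁).target) {P : M → Prop}
    (hP : ∀ᶠ z in 𝓝 ((extChartAt I x₁).symm y), P z) :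
    ∀ᶠ y' in 𝓝[range I] y, y' ∈ (extChartAt I x₁).target ∧ P ((extChartAt I x₁).symm y') := by
  refine Filter.Eventually.and (extChartAt_target_mem_nhdsWithin_of_mem hy) ?_
  exact ((continuousAt_extChartAt_symm'' hy).tendsto.eventually hP).filter_mono nhdsWithin_le_nhds

end Charts

/-! ### Smooth forms and the exterior derivative -/

section Smooth

variable {E : Type*} [NormedAddCommGroup E] [InnerProductSpace ℝ E] 
  {H : Type*} [TopologicalSpace H] {I : ModelWithCorners ℝ E H}
  {M : Type*} [TopologicalSpace M] [ChartedSpace H M] {p : ℕ}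

theorem minSmoothness_two_le : minSmoothness ℝ 2 ≤ (∞ : WithTop ℕ∞) := by
  rw [minSmoothness_of_isRCLikeNormedField]
  exact WithTop.coe_le_coe.2 (le_top : (2 : ℕ∞) ≤ ⊤)

/-- Smoothness of a form at a point. -/
def SmoothFormAt (α : FormField I M p) (x : M) : Prop :=
  ContDiffWithinAt ℝ ∞ (chartRep x α) (range I) (extChartAt I x x)

theorem extChartAt_mem_range (x₀ z : M) : extChartAt I x₀ z ∈ range I := by
  simp [extChartAt]

theorem mapsTo_transition (x₁ x₀ : M) (s : Set E) : MapsTo (transition I x₁ x₀) s (range I) :=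
  fun _ _ => extChartAt_mem_range _ _

theorem SmoothFormAt.congr {α β : FormField I M p} {x : M} (hα : SmoothFormAt α x)
    (h : ∀ᶠ z in 𝓝 x, β z = α z) : SmoothFormAt β x := by
  have h' : ∀ᶠ z in 𝓝 ((extChartAt I x).symm (extChartAt I x x)), β z = α z := by
    rwa [extChartAt_to_inv]
  refine ContDiffWithinAt.congr_of_eventuallyEq hα ?_ ?_
  · filter_upwards [eventually_target_and (mem_extChartAt_target x) h'] with y hy
    exact chartRep_congr hy.2
  · exact chartRep_congr h'.self_of_nhds

theorem extD_def (α : FormField I M p) (x : M) :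
    extD α x = (extDerivWithin (chartRep x α) (range I)
      (extChartAt I x x)).compContinuousLinearMap (chartD I x x) := rfl

theorem extD_congr {α β : FormField I M p} {x : M} (h : ∀ᶠ z in 𝓝 x, α z = β z) :
    extD α x = extD β x := by
  have h' : ∀ᶠ z in 𝓝 ((extChartAt I x).symm (extChartAt I x x)), α z = β z := by
    rwa [extChartAt_to_inv]
  rw [extD_def, extD_def]
  congr 1
  refine Filter.EventuallyEq.extDerivWithin_eq ?_ (chartRep_congr h'.self_of_nhds)
  filter_upwards [eventually_target_and (mem_extChartAt_target x) h'] with y hy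
  exact chartRep_congr hy.2

theorem SmoothFormOn.mono {α : FormField I M p} {W W' : Set M} (h : SmoothFormOn α W)
    (hW : W' ⊆ W) : SmoothFormOn α W' :=
  fun x₀ => (h x₀).mono (inter_subset_inter_right _ (preimage_mono hW))

/-- The product of a function and a form. -/
def mulForm (f : M → ℝ) (α : FormField I M p) : FormField I M p := fun x => f x • α x

theorem chartRep_mulForm (f : M → ℝ) (α : FormField I M p) (x₀ : M) (y : E) :
    chartRep x₀ (mulForm f α) y = f ((extChartAt I x₀).symm y) • chartRep x₀ α y := rfl

theorem SmoothFormAt.mulForm {f : M → ℝ} {α : FormField I M p} {x : M} (hα : SmoothFormAt α x)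
    (hf : ContMDiffAt I 𝓘(ℝ) ∞ f x) : SmoothFormAt (mulForm f α) x := by
  have h1 : ContDiffWithinAt ℝ ∞ (f ∘ (extChartAt I x).symm) (range I) (extChartAt I x x) := by
    have := (contMDiffAt_iff.1 hf).2
    exact this
  exact ContDiffWithinAt.smul h1 hα

theorem SmoothFormAt.zero_of_eventually {α : FormField I M p} {x : M}
    (h : ∀ᶠ z in 𝓝 x, α z = 0) : SmoothFormAt α x := by
  refine SmoothFormAt.congr (α := 0) ?_ h
  unfold SmoothFormAt
  rw [chartRep_zero]
  exact contDiffWithinAt_const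

theorem SmoothFormOn.smoothFormAt {α : FormField I M p} {W : Set M} (hW : IsOpen W)
    (h : SmoothFormOn α W) {x : M} (hx : x ∈ W) : SmoothFormAt α x := by
  have h1 := h x (extChartAt I x x) ⟨mem_extChartAt_target x, by
    rwa [mem_preimage, extChartAt_to_inv]⟩
  refine h1.mono_of_mem_nhdsWithin ?_
  exact eventually_target_and (mem_extChartAt_target x) (hW.mem_nhds (by rwa [extChartAt_to_inv]))

variable [FiniteDimensional ℝ E] [IsManifold I ∞ M]

theorem contDiffWithinAt_chartRep_change {α : FormField I M p} {x₀ x₁ : M} {y : E}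
    (hy : y ∈ (extChartAt I x₁).target)
    (hy' : (extChartAt I x₁).symm y ∈ (extChartAt I x₀).source)
    (h : ContDiffWithinAt ℝ ∞ (chartRep x₀ α) (range I) (transition I x₁ x₀ y)) :
    ContDiffWithinAt ℝ ∞ (chartRep x₁ α) (range I) y := by
  have h1 := contDiffWithinAt_compContinuousLinearMap
    (h.comp y (contDiffWithinAt_transition hy hy') (mapsTo_transition _ _ _))
    (contDiffWithinAt_fderivWithin_transition hy hy')
  refine h1.congr_of_eventuallyEq ?_ (chartRep_change α hy hy')
  filter_upwards [eventually_target_and hy (extChartAt_source_mem_nhds' (I := I) hy')] with y' hy'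
  exact chartRep_change α hy'.1 hy'.2

theorem SmoothFormAt.contDiffWithinAt {α : FormField I M p} {x₀ : M} {y : E}
    (hy : y ∈ (extChartAt I x₀).target) (h : SmoothFormAt α ((extChartAt I x₀).symm y)) :
    ContDiffWithinAt ℝ ∞ (chartRep x₀ α) (range I) y :=
  contDiffWithinAt_chartRep_change hy (mem_extChartAt_source _) h

theorem smoothFormAt_of_chart {α : FormField I M p} {x₀ x : M}
    (hx : x ∈ (extChartAt I x₀).source)
    (h : ContDiffWithinAt ℝ ∞ (chartRep x₀ α) (range I) (extChartAt I x₀ x)) :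
    SmoothFormAt α x := by
  refine contDiffWithinAt_chartRep_change (x₀ := x₀) (mem_extChartAt_target x) ?_ ?_
  · rwa [extChartAt_to_inv]
  · rwa [transition, Function.comp_apply, extChartAt_to_inv]

theorem smoothFormOn_of_smoothFormAt {α : FormField I M p} {W : Set M}
    (h : ∀ x ∈ W, SmoothFormAt α x) : SmoothFormOn α W := fun x₀ _ hy =>
  ((h _ hy.2).contDiffWithinAt hy.1).mono
    (inter_subset_left.trans (extChartAt_target_subset_range x₀))

theorem SmoothFormOn.mulForm {f : M → ℝ} {α : FormField I M p} {W : Set M} (hW : IsOpen W)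
    (hα : SmoothFormOn α W) (hf : ContMDiff I 𝓘(ℝ) ∞ f) : SmoothFormOn (mulForm f α) W :=
  smoothFormOn_of_smoothFormAt fun x hx => (hα.smoothFormAt hW hx).mulForm (hf x)

/-- A form that is smooth on an open set becomes smooth everywhere when it is multiplied by a
function supported in this set. -/
theorem SmoothFormOn.mulForm_univ {f : M → ℝ} {α : FormField I M p} {W : Set M} (hW : IsOpen W)
    (hα : SmoothFormOn α W) (hf : ContMDiff I 𝓘(ℝ) ∞ f) (hfW : tsupport f ⊆ W) :
    SmoothFormOn (RelSullivan.mulForm f α) univ := by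
  refine smoothFormOn_of_smoothFormAt fun x _ => ?_
  by_cases hx : x ∈ W
  · exact (hα.smoothFormAt hW hx).mulForm (hf x)
  · refine SmoothFormAt.zero_of_eventually ?_
    have : (tsupport f)ᶜ ∈ 𝓝 x :=
      (isClosed_tsupport f).isOpen_compl.mem_nhds fun h => hx (hfW h)
    filter_upwards [this] with z hz
    change f z • α z = 0
    rw [image_eq_zero_of_notMem_tsupport hz, zero_smul]

omit [FiniteDimensional ℝ E] in
-- `extD` uses a different chart at each point; naturality of the exterior derivative under the
-- transition map shows that any fixed chart computes it. The range of the model lies in the closure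
-- of its interior, so this also covers boundary points.
theorem chartRep_extD {α : FormField I M p} {x₀ : M} {y : E} (hy : y ∈ (extChartAt I x₀).target)
    (h : SmoothFormAt α ((extChartAt I x₀).symm y)) :
    chartRep x₀ (extD α) y = extDerivWithin (chartRep x₀ α) (range I) y := by
  let z := (extChartAt I x₀).symm y
  have hyr := extChartAt_target_subset_range x₀ hy
  have hzs : (extChartAt I x₀).symm y ∈ (extChartAt I z).source := mem_extChartAt_source z
  have h1 : extDerivWithin (chartRep x₀ α) (range I) y =
      extDerivWithin (fun y' => (chartRep z α (transition I x₀ z y')).compContinuousLinearMap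
        (fderivWithin ℝ (transition I x₀ z) (range I) y')) (range I) y := by
    refine Filter.EventuallyEq.extDerivWithin_eq ?_ (chartRep_change α hy hzs)
    filter_upwards [eventually_target_and hy (extChartAt_source_mem_nhds' (I := I) hzs)]
      with y' hy'
    exact chartRep_change α hy'.1 hy'.2
  rw [h1, extDerivWithin_pullback (t := range I) (r := ∞)
    (f := transition I x₀ z) (x := y)
    (ContDiffWithinAt.differentiableWithinAt h (by simp)) (contDiffWithinAt_transition hy hzs)
    minSmoothness_two_le I.uniqueDiffOn (I.range_subset_closure_interior hyr) hyr (mapsTo_transition _ _ _),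
    ← chartD_comp_chartSymmD_eq hy hzs]
  rfl

theorem SmoothFormOn.extD {α : FormField I M p} {W : Set M} (hW : IsOpen W)
    (h : SmoothFormOn α W) : SmoothFormOn (extD α) W := by
  refine smoothFormOn_of_smoothFormAt fun x hx => ?_
  have h1 : ContDiffWithinAt ℝ ∞ (extDerivWithin (chartRep x α) (range I)) (range I)
      (extChartAt I x x) :=
    (ContinuousAlternatingMap.alternatizeUncurryFinCLM ℝ E
      ℝ).contDiff.contDiffAt.comp_contDiffWithinAt _ 
      ((h.smoothFormAt hW hx).fderivWithin_right I.uniqueDiffOn (by simp) (extChartAt_mem_range x x))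
  have hW' : W ∈ 𝓝 ((extChartAt I x).symm (extChartAt I x x)) := by
    rw [extChartAt_to_inv]; exact hW.mem_nhds hx
  refine ContDiffWithinAt.congr_of_eventuallyEq h1 ?_ ?_
  · filter_upwards [eventually_target_and (mem_extChartAt_target x) hW'] with y hy
    exact chartRep_extD hy.1 (h.smoothFormAt hW hy.2)
  · exact chartRep_extD (mem_extChartAt_target x) (h.smoothFormAt hW (mem_of_mem_nhds hW'))

omit [FiniteDimensional ℝ E] in
theorem extD_extD {α : FormField I M p} {W : Set M} (hW : IsOpen W) (h : SmoothFormOn α W) {x : M}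
    (hx : x ∈ W) : RelSullivan.extD (RelSullivan.extD α) x = 0 := by
  have hW' : W ∈ 𝓝 ((extChartAt I x).symm (extChartAt I x x)) := by
    rw [extChartAt_to_inv]; exact hW.mem_nhds hx
  rw [extD_def]
  have h1 : extDerivWithin (chartRep x (RelSullivan.extD α)) (range I) (extChartAt I x x) =
      extDerivWithin (extDerivWithin (chartRep x α) (range I)) (range I) (extChartAt I x x) := by
    refine Filter.EventuallyEq.extDerivWithin_eq ?_ ?_
    · filter_upwards [eventually_target_and (mem_extChartAt_target x) hW'] with y hy
      exact chartRep_extD hy.1 (h.smoothFormAt hW hy.2)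
    · exact chartRep_extD (mem_extChartAt_target x) (h.smoothFormAt hW (mem_of_mem_nhds hW'))
  rw [h1, extDerivWithin_extDerivWithin_apply (r := ∞) (h.smoothFormAt hW hx)
    minSmoothness_two_le
    I.uniqueDiffOn (I.range_subset_closure_interior (extChartAt_mem_range x x))
    (extChartAt_mem_range x x)]
  rfl

end Smooth

/-! ### Cutoff functions -/

section Cutoff

variable {E : Type*} [NormedAddCommGroup E] [InnerProductSpace ℝ E] [FiniteDimensional ℝ E]
  {H : Type*} [TopologicalSpace H] (I : ModelWithCorners ℝ E H)
  {M : Type*} [TopologicalSpace M] [ChartedSpace H M] [IsManifold I ∞ M] [T2Space M]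
  [SecondCountableTopology M]

theorem topology_of_manifold (I : ModelWithCorners ℝ E H) (M : Type*)
    [TopologicalSpace M] [ChartedSpace H M] [T2Space M] [SecondCountableTopology M] :
    LocallyCompactSpace M ∧ SigmaCompactSpace M ∧ NormalSpace M := by
  have h1 : LocallyCompactSpace M := Manifold.locallyCompact_of_finiteDimensional I
  have h2 : SigmaCompactSpace M := inferInstance
  exact ⟨h1, h2, inferInstance⟩

theorem exists_cutoff_of_isClosed {C W : Set M} (hC : IsClosed C) (hW : IsOpen W) (h : C ⊆ W) :
    ∃ f : M → ℝ, ContMDiff I 𝓘(ℝ) ∞ f ∧ (∀ᶠ x in 𝓝ˢ C, f x = 1) ∧ tsupport f ⊆ W ∧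
      ∀ x, f x ∈ Icc (0 : ℝ) 1 := by
  obtain ⟨_, _, _⟩ := topology_of_manifold I M
  obtain ⟨V, hV, hCV, hVW⟩ := normal_exists_closure_subset hC hW h
  obtain ⟨f, hf1, hf0, hf⟩ := exists_contMDiffMap_one_nhds_of_subset_interior I (n := ⊤) hC
    (hCV.trans (hV.subset_interior_iff.2 subset_rfl))
  refine ⟨f, f.contMDiff, hf1, ?_, hf⟩
  refine (closure_mono fun x hx => ?_).trans hVW
  by_contra hxV
  exact hx (hf0 x hxV)

theorem exists_cutoff_of_isCompact {C W : Set M} (hC : IsCompact C) (hW : IsOpen W) (h : C ⊆ W) :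
    ∃ f : M → ℝ, ContMDiff I 𝓘(ℝ) ∞ f ∧ (∀ᶠ x in 𝓝ˢ C, f x = 1) ∧ tsupport f ⊆ W ∧
      (∀ x, f x ∈ Icc (0 : ℝ) 1) ∧ IsCompact (tsupport f) := by
  obtain ⟨_, _, _⟩ := topology_of_manifold I M
  obtain ⟨V, hV, hCV, hVW, hVc⟩ := exists_open_between_and_isCompact_closure hC hW h
  obtain ⟨f, hf, hf1, hfV, hf01⟩ := exists_cutoff_of_isClosed I hC.isClosed hV hCV
  exact ⟨f, hf, hf1, hfV.trans (subset_closure.trans hVW), hf01,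
    hVc.of_isClosed_subset (isClosed_tsupport f) (hfV.trans subset_closure)⟩

end Cutoff

/-! ### Exact forms and cohomology classes -/

section Exact

variable {E : Type*} [NormedAddCommGroup E] [InnerProductSpace ℝ E]
  {H : Type*} [TopologicalSpace H] {I : ModelWithCorners ℝ E H}
  {M : Type*} [TopologicalSpace M] [ChartedSpace H M] {p : ℕ}

theorem extD_add_apply {α β : FormField I M p} {x : M} (hα : SmoothFormAt α x)
    (hβ : SmoothFormAt β x) : extD (α + β) x = extD α x + extD β x := by
  have hu : UniqueDiffWithinAt ℝ (range I) (extChartAt I x x) :=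
    I.uniqueDiffOn _ (mem_range_self _)
  rw [extD_def, extD_def, extD_def, chartRep_add, extDerivWithin_add hu
    (ContDiffWithinAt.differentiableWithinAt hα (by simp))
    (ContDiffWithinAt.differentiableWithinAt hβ (by simp))]
  rfl

theorem exactOn_of_eq_zero {α : FormField I M p} {W : Set M} (h : ∀ x ∈ W, α x = 0) :
    ExactOn α W := by
  cases p with
  | zero => exact h
  | succ p => exact ⟨0, SmoothFormOn.zero _, fun x hx => by rw [h x hx, extD_zero]; rfl⟩

theorem ExactOn.add {α δ : FormField I M p} {W : Set M} (hW : IsOpen W) (hα : ExactOn α W)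
    (hδ : ExactOn δ univ) : ExactOn (α + δ) W := by
  cases p with
  | zero =>
    intro x hx
    change α x + δ x = 0
    rw [hα x hx, hδ x trivial, add_zero]
  | succ p =>
    obtain ⟨a, ha, ha'⟩ := hα
    obtain ⟨d, hd, hd'⟩ := hδ
    refine ⟨a + d, ha.add (hd.mono (subset_univ _)), fun x hx => ?_⟩
    rw [extD_add_apply (ha.smoothFormAt hW hx) (hd.smoothFormAt isOpen_univ trivial)]
    change α x + δ x = _
    rw [ha' x hx, hd' x trivial]

theorem Represents.smooth {α : FormField I M p} {ξ : DeRham I M p} (h : Represents α ξ) :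
    SmoothFormOn α univ := by
  obtain ⟨a, rfl, -⟩ := h
  exact a.2.1

theorem represents_zero_iff {α : FormField I M p} :
    Represents α (0 : DeRham I M p) ↔ SmoothFormOn α univ ∧ extD α = 0 ∧ ExactOn α univ := by
  constructor
  · rintro ⟨a, rfl, h⟩
    exact ⟨a.2.1, a.2.2, (Submodule.Quotient.mk_eq_zero _).1 h⟩
  · rintro ⟨h1, h2, h3⟩
    exact ⟨⟨α, h1, h2⟩, rfl, (Submodule.Quotient.mk_eq_zero _).2 h3⟩

theorem Represents.add {α β : FormField I M p} {ξ ζ : DeRham I M p} (hα : Represents α ξ)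
    (hβ : Represents β ζ) : Represents (α + β) (ξ + ζ) := by
  obtain ⟨a, rfl, rfl⟩ := hα
  obtain ⟨b, rfl, rfl⟩ := hβ
  exact ⟨a + b, rfl, rfl⟩

theorem Represents.smul {α : FormField I M p} {ξ : DeRham I M p} (c : ℝ) (hα : Represents α ξ) :
    Represents (c • α) (c • ξ) := by
  obtain ⟨a, rfl, rfl⟩ := hα
  exact ⟨c • a, rfl, rfl⟩

theorem Represents.sub {α β : FormField I M p} {ξ ζ : DeRham I M p} (hα : Represents α ξ)
    (hβ : Represents β ζ) : Represents (α - β) (ξ - ζ) := by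
  obtain ⟨a, rfl, rfl⟩ := hα
  obtain ⟨b, rfl, rfl⟩ := hβ
  exact ⟨a - b, rfl, rfl⟩

theorem Represents.exactOn_sub {α β : FormField I M p} {ξ : DeRham I M p} (hα : Represents α ξ)
    (hβ : Represents β ξ) : ExactOn (α - β) univ := by
  have h := hα.sub hβ
  rw [sub_self] at h
  exact (represents_zero_iff.1 h).2.2

theorem Represents.add_zero {α δ : FormField I M p} {ξ : DeRham I M p} (hα : Represents α ξ)
    (hδ : Represents δ (0 : DeRham I M p)) : Represents (α + δ) ξ := by
  have h := hα.add hδ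
  rwa [_root_.add_zero] at h

theorem formSupport_subset {α : FormField I M p} {C : Set M} (hC : IsClosed C)
    (h : ∀ x ∉ C, α x = 0) : formSupport α ⊆ C :=
  closure_minimal (fun x hx => by by_contra hn; exact hx (h x hn)) hC

theorem mem_testForms_of_eq_zero {α : FormField I M p} (hα : SmoothFormOn α univ) {C : Set M}
    (hC : IsCompact C) (hC' : IsClosed C) (h : ∀ x ∉ C, α x = 0) : α ∈ testForms I M p :=
  ⟨hα, hC.of_isClosed_subset isClosed_closure (formSupport_subset hC' h)⟩

variable [FiniteDimensional ℝ E] [IsManifold I ∞ M]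

theorem represents_extD {η : FormField I M p} (hη : SmoothFormOn η univ) :
    Represents (extD η) (0 : DeRham I M (p + 1)) :=
  represents_zero_iff.2 ⟨hη.extD isOpen_univ, funext fun _ => extD_extD isOpen_univ hη trivial,
    η, hη, fun _ _ => rfl⟩

/-- An exact form on an open set can be cut off to a globally exact form. -/
theorem ExactOn.exists_cutoff {α : FormField I M p} {W : Set M} (hW : IsOpen W)
    (hα : ExactOn α W) {f : M → ℝ} (hf : ContMDiff I 𝓘(ℝ) ∞ f) (hfW : tsupport f ⊆ W) :
    ∃ δ : FormField I M p, Represents δ (0 : DeRham I M p) ∧ (∀ x ∉ tsupport f, δ x = 0) ∧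
      ∀ x, (∀ᶠ z in 𝓝 x, f z = 1) → δ x = α x := by
  have hfW' : ∀ x, (∀ᶠ z in 𝓝 x, f z = 1) → x ∈ W := by
    intro x hx
    refine hfW (subset_closure ?_)
    rw [Function.mem_support, hx.self_of_nhds]
    exact one_ne_zero
  cases p with
  | zero =>
    -- In degree `0` exactness means vanishing, so there is nothing to cut off.
    refine ⟨0, represents_zero_iff.2 ⟨SmoothFormOn.zero _, extD_zero, fun _ _ => rfl⟩,
      fun _ _ => rfl, fun x hx => ?_⟩
    rw [hα x (hfW' x hx)]; rfl
  | succ p =>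
    obtain ⟨β, hβ, hβα⟩ := hα
    -- The primitive is cut off rather than the form: this preserves exactness, and `d(fβ) = dβ`
    -- wherever `f` is `1` on a neighborhood.
    refine ⟨extD (mulForm f β), represents_extD (hβ.mulForm_univ hW hf hfW), fun x hx => ?_,
      fun x hx => ?_⟩
    · have : ∀ᶠ z in 𝓝 x, mulForm f β z = (0 : FormField I M p) z := by
        filter_upwards [(isClosed_tsupport f).isOpen_compl.mem_nhds hx] with z hz
        change f z • β z = 0
        rw [image_eq_zero_of_notMem_tsupport hz, zero_smul]
      rw [extD_congr this, extD_zero]; rfl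
    · rw [hβα x (hfW' x hx)]
      refine extD_congr ?_
      filter_upwards [hx] with z hz
      change f z • β z = β z
      rw [hz, one_smul]

theorem mulForm_mem_testForms {f : M → ℝ} {α : FormField I M p} {W : Set M} (hW : IsOpen W)
    (hα : SmoothFormOn α W) (hf : ContMDiff I 𝓘(ℝ) ∞ f) (hfW : tsupport f ⊆ W)
    (hfc : IsCompact (tsupport f)) : mulForm f α ∈ testForms I M p :=
  mem_testForms_of_eq_zero (hα.mulForm_univ hW hf hfW) hfc (isClosed_tsupport f) fun x hx => by
    change f x • α x = 0
    rw [image_eq_zero_of_notMem_tsupport hx, zero_smul]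

end Exact

/-! ### Estimates on cones -/

/-- On the compact base `a` has a positive minimum and the norm is bounded; the quotient of the two
constants works on the whole cone by homogeneity. An empty base means that the cone is `{0}`. -/
theorem IsCompactCone.exists_norm_le {V : Type*} [NormedAddCommGroup V] [NormedSpace ℝ V]
    {C : PointedCone ℝ V} (hC : IsCompactCone C) {a : V →L[ℝ] ℝ}
    (ha : ∀ v ∈ C, v ≠ 0 → 0 < a v) : ∃ ε > 0, ∀ v ∈ C, ε * ‖v‖ ≤ a v := by
  obtain ⟨L, hL, hK⟩ := hC
  have hscale : ∀ v ∈ C, v ≠ 0 → (L v)⁻¹ • v ∈ {v | v ∈ C ∧ L v = 1} := by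
    intro v hv hv0
    refine ⟨C.smul_mem (inv_pos.2 (hL v hv hv0)).le hv, ?_⟩
    rw [map_smul, smul_eq_mul, inv_mul_cancel₀ (hL v hv hv0).ne']
  rcases {v | v ∈ C ∧ L v = 1}.eq_empty_or_nonempty with he | hne
  · refine ⟨1, one_pos, fun v hv => ?_⟩
    have : v = 0 := by
      by_contra h0
      exact (he ▸ hscale v hv h0 : _ ∈ (∅ : Set V))
    simp [this]
  · obtain ⟨k, hk, hkm⟩ := hK.exists_isMinOn hne a.continuous.continuousOn
    obtain ⟨R, hR⟩ := hK.isBounded.exists_norm_le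
    have hk0 : k ≠ 0 := by
      rintro rfl
      simpa using hk.2
    have hak := ha k hk.1 hk0
    have hR0 : 0 < R := (norm_pos_iff.2 hk0).trans_le (hR k hk)
    refine ⟨a k / R, by positivity, fun v hv => ?_⟩
    rcases eq_or_ne v 0 with rfl | h0
    · simp
    have hLv := hL v hv h0
    have h1 : a k ≤ (L v)⁻¹ * a v := by
      have := hkm (hscale v hv h0)
      simpa using this
    have h2 : (L v)⁻¹ * ‖v‖ ≤ R := by
      have := hR _ (hscale v hv h0)
      rwa [norm_smul, norm_inv, Real.norm_of_nonneg hLv.le] at this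
    have h3 : ‖v‖ ≤ R * L v := by
      rw [inv_mul_le_iff₀ hLv] at h2; linarith
    have h4 : a k * L v ≤ a v := by
      rw [inv_mul_eq_div, le_div_iff₀ hLv] at h1; exact h1
    rw [div_mul_eq_mul_div, div_le_iff₀ hR0]
    nlinarith

section Cones

variable {E : Type*} [NormedAddCommGroup E] [InnerProductSpace ℝ E]
  {H : Type*} [TopologicalSpace H] {I : ModelWithCorners ℝ E H}
  {M : Type*} [TopologicalSpace M] [ChartedSpace H M] {p : ℕ} {X Z : Set M}

variable (I) in
/-- The map on `p`-vectors induced by the differential of a chart. -/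
def chartMap (p : ℕ) (x₀ x : M) : ⋀[ℝ]^p (TangentSpace I x) →ₗ[ℝ] ⋀[ℝ]^p E :=
  exteriorPower.map p (chartD I x₀ x).toLinearMap

theorem mem_coneInChart {x₀ x : M} {C : PointedCone ℝ (⋀[ℝ]^p (TangentSpace I x))}
    {w : ⋀[ℝ]^p E} : w ∈ coneInChart x₀ x C ↔ ∃ v ∈ C, chartMap I p x₀ x v = w :=
  PointedCone.mem_map

theorem chartMap_mem {x₀ x : M} {C : PointedCone ℝ (⋀[ℝ]^p (TangentSpace I x))}
    {v : ⋀[ℝ]^p (TangentSpace I x)} (hv : v ∈ C) : chartMap I p x₀ x v ∈ coneInChart x₀ x C :=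
  mem_coneInChart.2 ⟨v, hv, rfl⟩

/-- The form given by the function `F` in the chart around `x₀`. -/
def pullForm (x₀ : M) (F : E → E [⋀^Fin p]→L[ℝ] ℝ) : FormField I M p := fun x =>
  (F (extChartAt I x₀ x)).compContinuousLinearMap (chartD I x₀ x)

variable [IsManifold I ∞ M]

theorem chartMap_injective {x₀ x : M} (hx : x ∈ (extChartAt I x₀).source) :
    Function.Injective (chartMap I p x₀ x) := by
  obtain ⟨y, hy, rfl⟩ := exists_mem_target_eq hx
  exact exteriorPower_map_injective_of_comp_eq_id (chartSymmD_comp_chartD hy)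

theorem chartRep_pullForm {x₀ : M} {y : E} (hy : y ∈ (extChartAt I x₀).target)
    (F : E → E [⋀^Fin p]→L[ℝ] ℝ) : chartRep x₀ (pullForm (I := I) x₀ F) y = F y := by
  rw [chartRep_def, pullForm, (extChartAt I x₀).right_inv hy]
  ext v
  change F y _ = F y v
  congr 1
  funext i
  exact DFunLike.congr_fun (chartD_comp_chartSymmD hy) (v i)

omit [IsManifold I ∞ M] in
theorem evalPVector_pullForm (x₀ : M) (F : E → E [⋀^Fin p]→L[ℝ] ℝ) (x : M)
    (v : ⋀[ℝ]^p (TangentSpace I x)) :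
    evalPVector (pullForm x₀ F x) v = evalPVector (F (extChartAt I x₀ x)) (chartMap I p x₀ x v) :=
  evalPVector_comp _ _ _

/-- Change of charts for `p`-vectors, in terms of forms. -/
theorem evalPVector_chartMap_change {x₀ x₁ x : M} (h₀ : x ∈ (extChartAt I x₀).source)
    (h₁ : x ∈ (extChartAt I x₁).source) (b : E [⋀^Fin p]→L[ℝ] ℝ)
    (v : ⋀[ℝ]^p (TangentSpace I x)) :
    evalPVector b (chartMap I p x₀ x v) = evalPVector (b.compContinuousLinearMap
      (fderivWithin ℝ (transition I x₁ x₀) (range I) (extChartAt I x₁ x)))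
      (chartMap I p x₁ x v) := by
  have h := chartRep_change (pullForm (I := I) x₀ fun _ => b) ((extChartAt I x₁).map_source h₁)
    (x₀ := x₀) (by rwa [(extChartAt I x₁).left_inv h₁])
  have e : transition I x₁ x₀ (extChartAt I x₁ x) = extChartAt I x₀ x := by
    rw [transition, Function.comp_apply, (extChartAt I x₁).left_inv h₁]
  rw [e, chartRep_pullForm ((extChartAt I x₀).map_source h₀)] at h
  rw [← h, ← evalPVector_pullForm x₀ (fun _ => b) x v, evalPVector_eq_chartRep _ h₁]
  rfl

variable [FiniteDimensional ℝ E]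

theorem smoothFormAt_pullForm {x₀ x : M} (hx : x ∈ (extChartAt I x₀).source)
    {F : E → E [⋀^Fin p]→L[ℝ] ℝ} (hF : ContDiffWithinAt ℝ ∞ F (range I) (extChartAt I x₀ x)) :
    SmoothFormAt (pullForm (I := I) x₀ F) x := by
  refine smoothFormAt_of_chart hx (hF.congr_of_eventuallyEq ?_
    (chartRep_pullForm ((extChartAt I x₀).map_source hx) F))
  filter_upwards [extChartAt_target_mem_nhdsWithin' hx] with y hy
  exact chartRep_pullForm hy F

variable (S : RelConeStructure I p X Z)

omit [IsManifold I ∞ M] in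
-- A unit vector of a nearby cone is close to a unit vector of the cone at `x₁`. Moving the vector
-- and moving the form each cost at most `ε / 4`, leaving `ε / 2`.
theorem RelConeStructure.eventually_le {x₁ : M} (hx₁ : x₁ ∈ X \ Z) {a : E [⋀^Fin p]→L[ℝ] ℝ}
    {ε : ℝ} (hε : 0 < ε)
    (ha : ∀ w ∈ coneInChart x₁ x₁ (S.cone x₁), ε * ‖w‖ ≤ evalPVector a w) :
    ∃ δ > 0, ∀ᶠ y in 𝓝[X \ Z] x₁, ∀ b : E [⋀^Fin p]→L[ℝ] ℝ, ‖b - a‖ < δ →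
      ∀ w ∈ coneInChart x₁ y (S.cone y), ε / 2 * ‖w‖ ≤ evalPVector b w := by
  obtain ⟨C, hC, hCb⟩ := exists_evalPVector_bound E p
  -- The summand `1` keeps the radius meaningful when `a = 0`.
  have hr : 0 < ε / (4 * (C * ‖a‖ + 1)) := by positivity
  refine ⟨ε / (4 * C), by positivity, ?_⟩
  have h := (S.continuous_cone x₁ hx₁).eventually
    (gt_mem_nhds (ENNReal.ofReal_pos.2 hr))
  filter_upwards [h] with y hy b hb w hw
  rcases eq_or_ne w 0 with rfl | hw0
  · simp [evalPVector]
  have hwn : 0 < ‖w‖ := norm_pos_iff.2 hw0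
  set u := ‖w‖⁻¹ • w with hu
  have hu1 : ‖u‖ = 1 := by
    rw [hu, norm_smul, norm_inv, norm_norm, inv_mul_cancel₀ hwn.ne']
  have huC : u ∈ coneInChart x₁ y (S.cone y) :=
    (coneInChart x₁ y (S.cone y)).smul_mem (inv_pos.2 hwn).le hw
  obtain ⟨u', ⟨hu'C, hu'1⟩, hd⟩ := Metric.exists_edist_lt_of_hausdorffEDist_lt
    (show u ∈ {w : ⋀[ℝ]^p E | w ∈ coneInChart x₁ y (S.cone y) ∧ ‖w‖ = 1} from ⟨huC, hu1⟩) hy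
  have hd' : ‖u - u'‖ ≤ ε / (4 * (C * ‖a‖ + 1)) := by
    rw [edist_dist, ENNReal.ofReal_lt_ofReal_iff hr, dist_eq_norm] at hd
    exact hd.le
  have e1 : evalPVector b u = evalPVector a u' + evalPVector a (u - u') +
      evalPVector (b - a) u := by
    simp only [evalPVector, map_sub]
    have : (b - a).toAlternatingMap = b.toAlternatingMap - a.toAlternatingMap := rfl
    rw [this, map_sub, LinearMap.sub_apply]
    ring
  have e2 : ε ≤ evalPVector a u' := by
    have := ha u' hu'C
    rwa [hu'1, mul_one] at this
  have e3 : |evalPVector a (u - u')| ≤ ε / 4 := by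
    refine (hCb a _).trans ?_
    calc C * ‖a‖ * ‖u - u'‖ ≤ (C * ‖a‖ + 1) * (ε / (4 * (C * ‖a‖ + 1))) := by
          gcongr; linarith
      _ = ε / 4 := by field_simp
  have e4 : |evalPVector (b - a) u| ≤ ε / 4 := by
    refine (hCb _ u).trans ?_
    rw [hu1, mul_one]
    calc C * ‖b - a‖ ≤ C * (ε / (4 * C)) := by gcongr
      _ = ε / 4 := by field_simp
  have e5 : ε / 2 ≤ evalPVector b u := by
    rw [e1]
    linarith [abs_le.1 e3, abs_le.1 e4]
  have e6 : evalPVector b w = ‖w‖ * evalPVector b u := by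
    simp only [evalPVector, hu, map_smul, smul_eq_mul]
    field_simp
  rw [e6, mul_comm]
  gcongr

/-- A form that is positive on the cone at a point is bounded below on the nearby cones. -/
theorem RelConeStructure.eventually_le_form {x₁ : M} (hx₁ : x₁ ∈ X \ Z) {θ : FormField I M p}
    (hθ : SmoothFormAt θ x₁) (hpos : ∀ v ∈ S.cone x₁, v ≠ 0 → 0 < evalPVector (θ x₁) v) :
    ∃ ε > 0, ∀ᶠ y in 𝓝[X \ Z] x₁, ∀ v ∈ S.cone y,
      ε * ‖chartMap I p x₁ y v‖ ≤ evalPVector (θ y) v := by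
  set a := chartRep x₁ θ (extChartAt I x₁ x₁)
  have hs := mem_extChartAt_source (I := I) x₁
  obtain ⟨ε, hε, h1⟩ := (S.isCompactCone x₁ hx₁).exists_norm_le
    (a := LinearMap.toContinuousLinearMap
      (exteriorPower.alternatingMapLinearEquiv a.toAlternatingMap)) (by
      intro w hw hw0
      obtain ⟨v, hv, rfl⟩ := mem_coneInChart.1 hw
      have hv0 : v ≠ 0 := by rintro rfl; exact hw0 (map_zero _)
      have := hpos v hv hv0
      rwa [evalPVector_eq_chartRep θ hs] at this)
  obtain ⟨δ, hδ, h2⟩ := S.eventually_le hx₁ hε h1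
  refine ⟨ε / 2, by positivity, ?_⟩
  have hcont : Tendsto (fun y => chartRep x₁ θ (extChartAt I x₁ y)) (𝓝 x₁) (𝓝 a) := by
    refine hθ.continuousWithinAt.tendsto.comp ?_
    exact tendsto_nhdsWithin_iff.2 ⟨continuousAt_extChartAt x₁,
      Eventually.of_forall fun _ => extChartAt_mem_range _ _⟩
  have h3 : ∀ᶠ y in 𝓝 x₁, ‖chartRep x₁ θ (extChartAt I x₁ y) - a‖ < δ := by
    filter_upwards [hcont.eventually (Metric.ball_mem_nhds a hδ)] with y hy
    rwa [← dist_eq_norm]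
  filter_upwards [h2, h3.filter_mono nhdsWithin_le_nhds,
    Filter.Eventually.filter_mono nhdsWithin_le_nhds (extChartAt_source_mem_nhds (I := I) x₁)]
    with y hy1 hy2 hy3 v hv
  rw [evalPVector_eq_chartRep θ hy3]
  exact hy1 _ hy2 _ (chartMap_mem hv)

/-- A form that is positive on the cone at a point dominates all forms on the nearby cones. -/
theorem RelConeStructure.eventually_abs_le {x₁ x₀ : M} (hx₁ : x₁ ∈ X \ Z)
    (hx₀ : x₁ ∈ (extChartAt I x₀).source) {θ : FormField I M p}
    (hθ : SmoothFormAt θ x₁) (hpos : ∀ v ∈ S.cone x₁, v ≠ 0 → 0 < evalPVector (θ x₁) v) :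
    ∃ D ≥ 0, ∀ᶠ y in 𝓝[X \ Z] x₁, ∀ b : E [⋀^Fin p]→L[ℝ] ℝ, ∀ v ∈ S.cone y,
      |evalPVector b (chartMap I p x₀ y v)| ≤ D * ‖b‖ * evalPVector (θ y) v := by
  obtain ⟨C, hC, hCb⟩ := exists_evalPVector_bound E p
  obtain ⟨ε, hε, h1⟩ := S.eventually_le_form hx₁ hθ hpos
  set A : M → E →L[ℝ] E := fun y =>
    fderivWithin ℝ (transition I x₁ x₀) (range I) (extChartAt I x₁ y)
  have hcont : Tendsto A (𝓝 x₁) (𝓝 (A x₁)) := by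
    refine (contDiffWithinAt_fderivWithin_transition (mem_extChartAt_target x₁)
      (by rwa [extChartAt_to_inv])).continuousWithinAt.tendsto.comp ?_
    exact tendsto_nhdsWithin_iff.2 ⟨continuousAt_extChartAt x₁,
      Eventually.of_forall fun _ => extChartAt_mem_range _ _⟩
  have h2 : ∀ᶠ y in 𝓝 x₁, ‖A y‖ < ‖A x₁‖ + 1 :=
    hcont.norm.eventually (gt_mem_nhds (lt_add_one _))
  -- Pulling a `p`-form back by the differential `A y` of the transition multiplies its norm by at
  -- most `‖A y‖ ^ p`, and `ε` bounds `θ` below by the norm of the `p`-vector.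
  refine ⟨C * (‖A x₁‖ + 1) ^ p / ε, by positivity, ?_⟩
  filter_upwards [h1, h2.filter_mono nhdsWithin_le_nhds,
    Filter.Eventually.filter_mono nhdsWithin_le_nhds (extChartAt_source_mem_nhds (I := I) x₁),
    Filter.Eventually.filter_mono nhdsWithin_le_nhds (extChartAt_source_mem_nhds' (I := I) hx₀)]
    with y hy1 hy2 hy3 hy4 b v hv
  rw [evalPVector_chartMap_change hy4 hy3]
  have hn : ‖b.compContinuousLinearMap (A y)‖ ≤ ‖b‖ * (‖A x₁‖ + 1) ^ p := by
    refine (ContinuousAlternatingMap.norm_compContinuousLinearMap_le _ _).trans ?_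
    rw [Fintype.card_fin]
    gcongr
  have hv1 : ‖chartMap I p x₁ y v‖ ≤ evalPVector (θ y) v / ε := by
    rw [le_div_iff₀ hε, mul_comm]; exact hy1 v hv
  calc _ ≤ C * ‖b.compContinuousLinearMap (A y)‖ * ‖chartMap I p x₁ y v‖ := hCb _ _
    _ ≤ C * (‖b‖ * (‖A x₁‖ + 1) ^ p) * (evalPVector (θ y) v / ε) := by gcongr
    _ = _ := by ring

omit [IsManifold I ∞ M] in
theorem RelConeStructure.PosOn.nonneg {S : RelConeStructure I p X Z} {α : FormField I M p}
    {A : Set M} (h : S.PosOn α A) : S.NonnegOn α A := by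
  intro x hx v hv
  rcases eq_or_ne v 0 with rfl | h0
  · simp [evalPVector]
  · exact (h x hx v hv h0).le

/-- A form that is positive on the cones over a compact set dominates, in a chart, all forms. -/
theorem RelConeStructure.exists_abs_le_chart {A : Set M} {θ : FormField I M p}
    (hθ : SmoothFormOn θ univ) (hpos : S.PosOn θ A) (x₀ : M) {K : Set M} (hK : IsCompact K)
    (hK₀ : K ⊆ (extChartAt I x₀).source) (hKA : K ⊆ A ∩ (X \ Z)) :
    ∃ D ≥ 0, ∀ x ∈ K, ∀ b : E [⋀^Fin p]→L[ℝ] ℝ, ∀ v ∈ S.cone x,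
      |evalPVector b (chartMap I p x₀ x v)| ≤ D * ‖b‖ * evalPVector (θ x) v := by
  have hnn := hpos.nonneg
  have key : ∃ D ≥ 0, ∀ x ∈ K ∩ K, ∀ b : E [⋀^Fin p]→L[ℝ] ℝ, ∀ v ∈ S.cone x,
      |evalPVector b (chartMap I p x₀ x v)| ≤ D * ‖b‖ * evalPVector (θ x) v := by
    -- The local constants may be added over unions because `θ` is nonnegative on the cones.
    refine hK.induction_on (p := fun s => ∃ D ≥ 0, ∀ x ∈ s ∩ K, ∀ b : E [⋀^Fin p]→L[ℝ] ℝ,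
      ∀ v ∈ S.cone x, |evalPVector b (chartMap I p x₀ x v)| ≤ D * ‖b‖ * evalPVector (θ x) v)
      ?_ ?_ ?_ ?_
    · exact ⟨0, le_rfl, fun x hx => hx.1.elim⟩
    · rintro s t hst ⟨D, hD, h⟩
      exact ⟨D, hD, fun x hx => h x ⟨hst hx.1, hx.2⟩⟩
    · rintro s t ⟨D, hD, h⟩ ⟨D', hD', h'⟩
      refine ⟨D + D', by positivity, fun x hx b v hv => ?_⟩
      have h0 : 0 ≤ ‖b‖ * evalPVector (θ x) v :=
        mul_nonneg (norm_nonneg _) (hnn x (hKA hx.2) v hv)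
      rcases hx.1 with h1 | h1
      · refine (h x ⟨h1, hx.2⟩ b v hv).trans ?_
        nlinarith
      · refine (h' x ⟨h1, hx.2⟩ b v hv).trans ?_
        nlinarith
    · intro x₁ hx₁
      obtain ⟨D, hD, h⟩ := S.eventually_abs_le (hKA hx₁).2 (hK₀ hx₁)
        (hθ.smoothFormAt isOpen_univ trivial) (hpos x₁ (hKA hx₁))
      refine ⟨{y | ∀ b : E [⋀^Fin p]→L[ℝ] ℝ, ∀ v ∈ S.cone y,
        |evalPVector b (chartMap I p x₀ y v)| ≤ D * ‖b‖ * evalPVector (θ y) v}, ?_, D, hD,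
        fun x hx => hx.1⟩
      exact nhdsWithin_mono _ (fun z hz => (hKA hz).2) h
  simpa only [inter_self] using key

/-- A form that is positive on the cones over a compact set dominates any smooth form there. -/
theorem RelConeStructure.exists_abs_le {A : Set M} {θ β : FormField I M p}
    (hθ : SmoothFormOn θ univ) (hβ : SmoothFormOn β univ) (hpos : S.PosOn θ A) {K : Set M}
    (hK : IsCompact K) (hKA : K ⊆ A ∩ (X \ Z)) :
    ∃ D ≥ 0, ∀ x ∈ K, ∀ v ∈ S.cone x, |evalPVector (β x) v| ≤ D * evalPVector (θ x) v := by
  have hnn := hpos.nonneg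
  have key : ∃ D ≥ 0, ∀ x ∈ K ∩ K, ∀ v ∈ S.cone x,
      |evalPVector (β x) v| ≤ D * evalPVector (θ x) v := by
    refine hK.induction_on (p := fun s => ∃ D ≥ 0, ∀ x ∈ s ∩ K, ∀ v ∈ S.cone x,
      |evalPVector (β x) v| ≤ D * evalPVector (θ x) v) ?_ ?_ ?_ ?_
    · exact ⟨0, le_rfl, fun x hx => hx.1.elim⟩
    · rintro s t hst ⟨D, hD, h⟩
      exact ⟨D, hD, fun x hx => h x ⟨hst hx.1, hx.2⟩⟩
    · rintro s t ⟨D, hD, h⟩ ⟨D', hD', h'⟩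
      refine ⟨D + D', by positivity, fun x hx v hv => ?_⟩
      have h0 := hnn x (hKA hx.2) v hv
      rcases hx.1 with h1 | h1
      · refine (h x ⟨h1, hx.2⟩ v hv).trans ?_
        nlinarith
      · refine (h' x ⟨h1, hx.2⟩ v hv).trans ?_
        nlinarith
    · intro x₁ hx₁
      obtain ⟨D, hD, h⟩ := S.eventually_abs_le (hKA hx₁).2 (mem_extChartAt_source x₁)
        (hθ.smoothFormAt isOpen_univ trivial) (hpos x₁ (hKA hx₁))
      set a := chartRep x₁ β (extChartAt I x₁ x₁)
      have hcont : Tendsto (fun y => chartRep x₁ β (extChartAt I x₁ y)) (𝓝 x₁) (𝓝 a) := by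
        refine (hβ.smoothFormAt isOpen_univ (x := x₁) trivial).continuousWithinAt.tendsto.comp ?_
        exact tendsto_nhdsWithin_iff.2 ⟨continuousAt_extChartAt x₁,
          Eventually.of_forall fun _ => extChartAt_mem_range _ _⟩
      have h2 : ∀ᶠ y in 𝓝 x₁, ‖chartRep x₁ β (extChartAt I x₁ y)‖ < ‖a‖ + 1 :=
        hcont.norm.eventually (gt_mem_nhds (lt_add_one _))
      refine ⟨{y | y ∈ K → ∀ v ∈ S.cone y,
        |evalPVector (β y) v| ≤ D * (‖a‖ + 1) * evalPVector (θ y) v}, ?_, D * (‖a‖ + 1),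
        by positivity, fun x hx => hx.1 hx.2⟩
      filter_upwards [nhdsWithin_mono _ (fun z hz => (hKA hz).2) h,
        h2.filter_mono nhdsWithin_le_nhds, Filter.Eventually.filter_mono nhdsWithin_le_nhds
          (extChartAt_source_mem_nhds (I := I) x₁)] with y hy1 hy2 hy3 hyK v hv
      have h0 := hnn y (hKA hyK) v hv
      rw [evalPVector_eq_chartRep β hy3]
      refine (hy1 _ v hv).trans ?_
      gcongr
  simpa only [inter_self] using key

/-- Near a point off `Z` there is a test form that is positive on the cones there, and
nonnegative on all cones. -/
theorem RelConeStructure.exists_local_pos [T2Space M] [SecondCountableTopology M] {x₁ : M}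
    (hx₁ : x₁ ∈ X \ Z) : ∃ θ ∈ testForms I M p, S.NonnegOn θ univ ∧
      ∀ᶠ y in 𝓝[X \ Z] x₁, ∀ v ∈ S.cone y, v ≠ 0 → 0 < evalPVector (θ y) v := by
  obtain ⟨L, hL, -⟩ := S.isCompactCone x₁ hx₁
  obtain ⟨a, ha⟩ := exists_evalPVector_eq L.toLinearMap
  have hs := mem_extChartAt_source (I := I) x₁
  -- The functional `L` given by compactness of the cone is read as a form with constant
  -- coefficients in the chart.
  set θ₀ : FormField I M p := pullForm x₁ fun _ => a
  have hθ₀ : ∀ x ∈ (extChartAt I x₁).source, SmoothFormAt θ₀ x := fun x hx =>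
    smoothFormAt_pullForm hx contDiffWithinAt_const
  obtain ⟨ε, hε, h⟩ := S.eventually_le_form hx₁ (hθ₀ x₁ hs) (by
    intro v hv hv0
    rw [evalPVector_pullForm, ha]
    refine hL _ (chartMap_mem hv) fun h0 => hv0 (chartMap_injective hs ?_)
    rw [h0, map_zero])
  -- The cutoff will be supported where `θ₀` is already nonnegative on the cones, so the product is
  -- nonnegative on all cones.
  obtain ⟨N, hN, hN₁, hNs⟩ := mem_nhdsWithin.1 h
  set W := N ∩ (extChartAt I x₁).source
  have hW : IsOpen W := hN.inter (isOpen_extChartAt_source x₁)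
  obtain ⟨f, hf, hf1, hfW, hf01, hfc⟩ := exists_cutoff_of_isCompact I (isCompact_singleton (x := x₁))
    hW (singleton_subset_iff.2 ⟨hN₁, hs⟩)
  have heval : ∀ (x : M) (v : ⋀[ℝ]^p (TangentSpace I x)),
      evalPVector (mulForm f θ₀ x) v = f x * evalPVector (θ₀ x) v := fun x v =>
    evalPVector_smul _ _ _
  refine ⟨mulForm f θ₀, mulForm_mem_testForms hW
    (smoothFormOn_of_smoothFormAt fun x hx => hθ₀ x hx.2) hf hfW hfc, ?_, ?_⟩
  · intro x hx v hv
    rw [heval]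
    by_cases hxf : x ∈ tsupport f
    · have h1 : ε * ‖chartMap I p x₁ x v‖ ≤ evalPVector (θ₀ x) v :=
        hNs ⟨(hfW hxf).1, hx.2⟩ v hv
      exact mul_nonneg (hf01 x).1 (le_trans (by positivity) h1)
    · rw [image_eq_zero_of_notMem_tsupport hxf, zero_mul]
  · rw [nhdsSet_singleton] at hf1
    filter_upwards [h, hf1.filter_mono nhdsWithin_le_nhds, Filter.Eventually.filter_mono
      nhdsWithin_le_nhds (extChartAt_source_mem_nhds (I := I) x₁)] with y hy1 hy2 hy3 v hv hv0
    rw [heval, hy2, one_mul]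
    refine lt_of_lt_of_le ?_ (hy1 v hv)
    refine mul_pos hε (norm_pos_iff.2 fun h0 => hv0 (chartMap_injective hy3 ?_))
    rw [h0, map_zero]

/-- Finitely many local forms suffice by compactness. Each is nonnegative on all cones, so adding
them never destroys positivity. -/
theorem RelConeStructure.exists_posOn [T2Space M] [SecondCountableTopology M] {K : Set M}
    (hK : IsCompact K) (hKX : K ⊆ X \ Z) : ∃ θ ∈ testForms I M p, S.PosOn θ K := by
  have key : ∃ θ ∈ testForms I M p, S.NonnegOn θ univ ∧ S.PosOn θ K := by
    refine hK.induction_on (p := fun s => ∃ θ ∈ testForms I M p, S.NonnegOn θ univ ∧ S.PosOn θ s)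
      ?_ ?_ ?_ ?_
    · exact ⟨0, zero_mem _, fun x _ v _ => (evalPVector_zero v).ge, fun x hx => hx.1.elim⟩
    · rintro s t hst ⟨θ, h1, h2, h3⟩
      exact ⟨θ, h1, h2, fun x hx => h3 x ⟨hst hx.1, hx.2⟩⟩
    · rintro s t ⟨θ, h1, h2, h3⟩ ⟨θ', h1', h2', h3'⟩
      have heval : ∀ (x : M) (v : ⋀[ℝ]^p (TangentSpace I x)),
          evalPVector ((θ + θ') x) v = evalPVector (θ x) v + evalPVector (θ' x) v := fun x v =>
        evalPVector_add _ _ _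
      refine ⟨θ + θ', add_mem h1 h1', fun x hx v hv => ?_, fun x hx v hv hv0 => ?_⟩
      · rw [heval]
        exact add_nonneg (h2 x hx v hv) (h2' x hx v hv)
      · rw [heval]
        rcases hx.1 with h | h
        · exact add_pos_of_pos_of_nonneg (h3 x ⟨h, hx.2⟩ v hv hv0) (h2' x ⟨trivial, hx.2⟩ v hv)
        · exact add_pos_of_nonneg_of_pos (h2 x ⟨trivial, hx.2⟩ v hv) (h3' x ⟨h, hx.2⟩ v hv hv0)
    · intro x₁ hx₁
      obtain ⟨θ, h1, h2, h3⟩ := S.exists_local_pos (hKX hx₁)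
      obtain ⟨N, hN, hN₁, hNs⟩ := mem_nhdsWithin.1 h3
      exact ⟨N, mem_nhdsWithin_of_mem_nhds (hN.mem_nhds hN₁), θ, h1, h2,
        fun x hx => hNs ⟨hx.1, hx.2⟩⟩
  obtain ⟨θ, h1, -, h3⟩ := key
  exact ⟨θ, h1, h3⟩

end Cones

/-! ### Separation -/

section Separation

variable {E : Type*} [NormedAddCommGroup E] [InnerProductSpace ℝ E]
  {H : Type*} [TopologicalSpace H] {I : ModelWithCorners ℝ E H}
  {M : Type*} [TopologicalSpace M] [ChartedSpace H M] {p : ℕ} {X Z : Set M}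

theorem evalPVector_form_add (α β : FormField I M p) (x : M) (v : ⋀[ℝ]^p (TangentSpace I x)) :
    evalPVector ((α + β) x) v = evalPVector (α x) v + evalPVector (β x) v :=
  evalPVector_add _ _ _

theorem evalPVector_form_smul (c : ℝ) (α : FormField I M p) (x : M)
    (v : ⋀[ℝ]^p (TangentSpace I x)) :
    evalPVector ((c • α) x) v = c * evalPVector (α x) v :=
  evalPVector_smul _ _ _

variable [FiniteDimensional ℝ E] {S : RelConeStructure I p X Z}

theorem RelConeStructure.NonnegOn.add {α β : FormField I M p} {A : Set M}
    (hα : S.NonnegOn α A) (hβ : S.NonnegOn β A) : S.NonnegOn (α + β) A := fun x hx v hv => by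
  rw [evalPVector_form_add]
  exact add_nonneg (hα x hx v hv) (hβ x hx v hv)

theorem RelConeStructure.NonnegOn.smul {α : FormField I M p} {A : Set M} {c : ℝ} (hc : 0 ≤ c)
    (hα : S.NonnegOn α A) : S.NonnegOn (c • α) A := fun x hx v hv => by
  rw [evalPVector_form_smul]
  exact mul_nonneg hc (hα x hx v hv)

theorem RelConeStructure.nonnegOn_zero (A : Set M) : S.NonnegOn (0 : FormField I M p) A :=
  fun _ _ v _ => (evalPVector_zero v).ge

theorem RelConeStructure.NonnegOn.add_posOn {α β : FormField I M p} {A : Set M}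
    (hα : S.NonnegOn α A) (hβ : S.PosOn β A) : S.PosOn (α + β) A := fun x hx v hv hv0 => by
  rw [evalPVector_form_add]
  exact add_pos_of_nonneg_of_pos (hα x hx v hv) (hβ x hx v hv hv0)

theorem RelConeStructure.PosOn.smul {α : FormField I M p} {A : Set M} {c : ℝ} (hc : 0 < c)
    (hα : S.PosOn α A) : S.PosOn (c • α) A := fun x hx v hv hv0 => by
  rw [evalPVector_form_smul]
  exact mul_pos hc (hα x hx v hv hv0)

/-- The closed cone `𝓐_{U,0}` as a convex cone. -/
def RelConeStructure.closedConeZero (S : RelConeStructure I p X Z) (U : Set M) :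
    PointedCone ℝ (testForms I M p) where
  carrier := S.closedCone U 0
  add_mem' {α β} hα hβ := by
    refine ⟨fun x hx => ?_, hα.2.1.add hβ.2.1, hα.2.2.add_zero hβ.2.2⟩
    change α.1 x + β.1 x = 0
    rw [hα.1 x hx, hβ.1 x hx, add_zero]
  zero_mem' := ⟨fun _ _ => rfl, S.nonnegOn_zero _, ⟨0, rfl, rfl⟩⟩
  smul_mem' c α hα := by
    refine ⟨fun x hx => ?_, hα.2.1.smul c.2, ?_⟩
    · change (c : ℝ) • α.1 x = 0
      rw [hα.1 x hx, smul_zero]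
    · have h := hα.2.2.smul (c : ℝ)
      rwa [smul_zero] at h

/-- The cone of forms that are nonnegative over `A`. -/
def RelConeStructure.nonnegCone (S : RelConeStructure I p X Z) (A : Set M) :
    PointedCone ℝ (testForms I M p) where
  carrier := {α | S.NonnegOn α.1 A}
  add_mem' hα hβ := hα.add hβ
  zero_mem' := S.nonnegOn_zero A
  smul_mem' c _ hα := hα.smul c.2

variable [IsManifold I ∞ M]

/-- The forms positive over the compact set `X \ U` absorb all test forms. -/
theorem RelConeStructure.exists_nonnegOn_sub (hX : IsCompact X) {U : Set M} (hU : IsOpen U)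
    (hZU : Z ⊆ U) {θ : testForms I M p} (hθ : θ ∈ S.openCone U) (β : testForms I M p) :
    ∃ D : ℝ, 0 < D ∧ ∀ t : ℝ, |t| ≤ 1 → S.NonnegOn (D • θ + t • β : testForms I M p).1 Uᶜ := by
  have hXU : X \ U ⊆ Uᶜ ∩ (X \ Z) := fun x hx => ⟨hx.2, hx.1, fun h => hx.2 (hZU h)⟩
  obtain ⟨D, hD, h⟩ := S.exists_abs_le θ.2.1 β.2.1 hθ (hX.diff hU) hXU
  refine ⟨D + 1, by positivity, fun t ht x hx v hv => ?_⟩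
  have h1 := h x ⟨hx.2.1, hx.1⟩ v hv
  have h2 := RelConeStructure.PosOn.nonneg hθ x hx v hv
  change 0 ≤ evalPVector (((D + 1) • θ.1 + t • β.1) x) v
  rw [evalPVector_form_add, evalPVector_form_smul, evalPVector_form_smul]
  have h3 : |t * evalPVector (β.1 x) v| ≤ D * evalPVector (θ.1 x) v := by
    rw [abs_mul]
    calc |t| * |evalPVector (β.1 x) v| ≤ 1 * |evalPVector (β.1 x) v| := by gcongr
      _ ≤ _ := by rwa [one_mul]
  linarith [abs_le.1 h3]

/-- A functional that is nonnegative on the forms nonnegative over `X \ U` is a current. -/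
theorem RelConeStructure.isCurrent_of_nonneg [T2Space M] (hX : IsCompact X) {U : Set M}
    (hU : IsOpen U) (hZU : Z ⊆ U) {θ : testForms I M p} (hθ : θ ∈ S.openCone U) (T : testForms I M p →ₗ[ℝ] ℝ)
    (hT : ∀ α : testForms I M p, S.NonnegOn α.1 Uᶜ → 0 ≤ T α) : IsCurrent I T := by
  intro x₀ K hK hKs
  have hXU : K ∩ (X \ U) ⊆ Uᶜ ∩ (X \ Z) := fun x hx =>
    ⟨hx.2.2, hx.2.1, fun h => hx.2.2 (hZU h)⟩
  obtain ⟨D, hD, h⟩ := S.exists_abs_le_chart θ.2.1 hθ x₀ (hK.inter (hX.diff hU))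
    (fun x hx => by rw [extChartAt_source]; exact hKs hx.1) hXU
  -- Both `D * B * θ + α` and `D * B * θ - α` are nonnegative over `X \ U`, so `T` is bounded by the
  -- supremum of the coefficients alone: no derivative is needed.
  refine ⟨0, D * T θ, fun α hα B hB hb => ?_⟩
  have key : ∀ t : ℝ, |t| = 1 → 0 ≤ T ((D * B) • θ + t • α) := by
    intro t ht
    refine hT _ fun x hx v hv => ?_
    change 0 ≤ evalPVector (((D * B) • θ.1 + t • α.1) x) v
    rw [evalPVector_form_add, evalPVector_form_smul, evalPVector_form_smul]
    have h2 := RelConeStructure.PosOn.nonneg hθ x hx v hv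
    by_cases hxK : x ∈ K
    · have hxs : x ∈ (extChartAt I x₀).source := by
        rw [extChartAt_source]; exact hKs hxK
      have h1 := h x ⟨hxK, hx.2.1, hx.1⟩ (chartRep x₀ α.1 (extChartAt I x₀ x)) v hv
      have h1' : |evalPVector (α.1 x) v| ≤
          D * ‖chartRep x₀ α.1 (extChartAt I x₀ x)‖ * evalPVector (θ.1 x) v := by
        rw [evalPVector_eq_chartRep α.1 hxs]; exact h1
      have h3 : ‖chartRep x₀ α.1 (extChartAt I x₀ x)‖ ≤ B := by
        have := hb 0 le_rfl x hxK
        rwa [norm_iteratedFDerivWithin_zero] at this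
      have h4 : |t * evalPVector (α.1 x) v| ≤ D * B * evalPVector (θ.1 x) v := by
        rw [abs_mul, ht, one_mul]
        refine h1'.trans ?_
        gcongr
      linarith [abs_le.1 h4]
    · have h0 : α.1 x = 0 := by
        by_contra h0
        exact hxK (hα (subset_closure h0))
      rw [h0, evalPVector_zero, mul_zero, add_zero]
      positivity
  have k1 := key 1 (by simp)
  have k2 := key (-1) (by simp)
  simp only [map_add, map_smul, smul_eq_mul] at k1 k2
  rw [abs_le]
  constructor <;> nlinarith

/-- Separation of `γ + 𝓐_{U,0}` from `𝓞_U`: if they are disjoint, there is a structure cycle that is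
nonpositive on `γ`. -/
theorem RelConeStructure.exists_structureCycle [T2Space M] [SecondCountableTopology M]
    (S : RelConeStructure I p X Z) (hX : IsCompact X) {U : Set M} (hU : IsOpen U)
    (hZU : Z ⊆ U) (γ : testForms I M p)
    (hγ : ∀ a ∈ S.closedCone U 0, γ + a ∉ S.openCone U) :
    ∃ T : Current I M p, S.IsStructureCycle U T ∧ T.toLinearMap γ ≤ 0 := by
  obtain ⟨θ₀, hθ₀, hθ₀pos⟩ := S.exists_posOn (hX.diff hU)
    (fun x hx => ⟨hx.1, fun h => hx.2 (hZU h)⟩)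
  let θ : testForms I M p := ⟨θ₀, hθ₀⟩
  have hθ : θ ∈ S.openCone U := fun x hx => hθ₀pos x ⟨⟨hx.2.1, hx.1⟩, hx.2⟩
  -- Disjointness extends to all of `ℝ≥0 γ + 𝓐_{U,0}`. For `c > 0` rescale; for `c = 0`, a large
  -- multiple of an `a` lying in `𝓞_U` absorbs `γ` and would put `γ + (D + 1) a` in `𝓞_U`.
  have hγ' : ∀ a ∈ S.closedConeZero U, ∀ c : ℝ, 0 ≤ c → c • γ + a ∉ S.openCone U := by
    intro a ha c hc hmem
    rcases hc.eq_or_lt with rfl | hc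
    · rw [zero_smul, zero_add] at hmem
      obtain ⟨D, hD, hDn⟩ := S.exists_nonnegOn_sub hX hU hZU hmem γ
      refine hγ _ ((S.closedConeZero U).smul_mem (show (0 : ℝ) ≤ D + 1 by positivity) ha) ?_
      have h1 := (hDn 1 (by simp)).add_posOn hmem
      have h2 : (γ + (D + 1) • a : testForms I M p) = (D • a + (1 : ℝ) • γ) + a := by module
      rw [h2]
      exact h1
    · refine hγ _ ((S.closedConeZero U).smul_mem (inv_nonneg.2 hc.le) ha) ?_
      have h1 := RelConeStructure.PosOn.smul (inv_pos.2 hc) hmem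
      have h2 : (γ + c⁻¹ • a : testForms I M p) = c⁻¹ • (c • γ + a) := by
        rw [smul_add, smul_smul, inv_mul_cancel₀ hc.ne', one_smul]
      rw [h2]
      exact h1
  -- If `0` were in `𝓞_U`, every form would be in `𝓞_U`, in particular `γ`.
  have hθ0 : θ ≠ 0 := by
    intro h0
    rw [h0] at hθ
    refine hγ' 0 (zero_mem _) 1 zero_le_one ?_
    obtain ⟨D, hD, hDn⟩ := S.exists_nonnegOn_sub hX hU hZU hθ γ
    have h1 := (hDn 1 (by simp)).add_posOn hθ
    have h2 : ((1 : ℝ) • γ + 0 : testForms I M p) = (D • 0 + (1 : ℝ) • γ) + 0 := by module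
    rw [h2]
    exact h1
  -- A functional that is nonnegative on this sum of cones has all the required signs at once:
  -- nonnegative on forms nonnegative over `X \ U`, nonpositive on `γ` and on `𝓐_{U,0}`.
  let s : PointedCone ℝ (testForms I M p) := S.nonnegCone Uᶜ ⊔
    (PointedCone.hull ℝ {-γ} ⊔ (S.closedConeZero U).map (-LinearMap.id))
  have hmem : ∀ x ∈ s, ∃ o ∈ S.nonnegCone Uᶜ, ∃ c : ℝ, 0 ≤ c ∧ ∃ a ∈ S.closedConeZero U,
      x + (c • γ + a) = o := by
    intro x hx
    obtain ⟨o, ho, y, hy, rfl⟩ := Submodule.mem_sup.1 hx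
    obtain ⟨g, hg, z, hz, rfl⟩ := Submodule.mem_sup.1 hy
    obtain ⟨c, rfl⟩ := Submodule.mem_span_singleton.1 hg
    obtain ⟨a, ha, rfl⟩ := PointedCone.mem_map.1 hz
    refine ⟨o, ho, c, c.2, a, ha, ?_⟩
    change o + ((c : ℝ) • -γ + -a) + ((c : ℝ) • γ + a) = o
    module
  have hs1 : ∀ α ∈ S.nonnegCone Uᶜ, α ∈ s := fun α hα => Submodule.mem_sup_left hα
  let f : testForms I M p →ₗ.[ℝ] ℝ := LinearPMap.mkSpanSingleton θ (1 : ℝ) hθ0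
  obtain ⟨T, hTf, hTs⟩ := riesz_extension s f (by
    rintro ⟨x, hx⟩ hxs
    obtain ⟨t, rfl⟩ := Submodule.mem_span_singleton.1 hx
    have : f ⟨t • θ, hx⟩ = t :=
      (LinearPMap.mkSpanSingleton'_apply _ _ _ _ _).trans (mul_one t)
    rw [this]
    -- If `t θ ∈ s` with `t < 0`, moving `t θ` across writes an element `c γ + a` as a nonnegative
    -- form plus a positive multiple of `θ`, hence as an element of `𝓞_U`.
    by_contra! ht
    obtain ⟨o, ho, c, hc, a, ha, h⟩ := hmem _ hxs
    refine hγ' a ha c hc ?_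
    have h1 : c • γ + a = o + (-t) • θ := by
      rw [← h]; module
    rw [h1]
    exact RelConeStructure.NonnegOn.add_posOn ho (RelConeStructure.PosOn.smul (neg_pos.2 ht) hθ))
    (by
    -- The line spanned by `θ` is cofinal for the order given by `s`: `D θ + y` is nonnegative over
    -- `X \ U` for large `D`.
    intro y
    obtain ⟨D, hD, hDn⟩ := S.exists_nonnegOn_sub hX hU hZU hθ y
    refine ⟨⟨D • θ, (Submodule.smul_mem _ D (Submodule.mem_span_singleton_self θ) :
      D • θ ∈ Submodule.span ℝ {θ})⟩, hs1 _ ?_⟩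
    have h1 := hDn 1 (by simp)
    rw [one_smul] at h1
    exact h1)
  have hTθ : T θ = 1 := by
    have h1 := hTf ⟨θ, Submodule.mem_span_singleton_self θ⟩
    refine h1.trans ?_
    exact LinearPMap.mkSpanSingleton_apply ℝ ℝ hθ0 1
  have hTn : ∀ α : testForms I M p, S.NonnegOn α.1 Uᶜ → 0 ≤ T α := fun α hα =>
    hTs α (hs1 α hα)
  refine ⟨⟨T, RelConeStructure.isCurrent_of_nonneg hX hU hZU hθ T hTn⟩, ⟨?_, ?_⟩, ?_⟩
  · intro o ho
    -- Strict positivity: `D o - θ` is nonnegative over `X \ U`, so `D * T o ≥ T θ = 1`.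
    obtain ⟨D, hD, hDn⟩ := S.exists_nonnegOn_sub hX hU hZU ho θ
    have h1 := hTn _ (hDn (-1) (by simp))
    rw [map_add, map_smul, map_smul, hTθ, smul_eq_mul, smul_eq_mul] at h1
    change 0 < T o
    by_contra! h2
    nlinarith
  · intro a ha
    have h1 := hTs (-a) (Submodule.mem_sup_right (Submodule.mem_sup_right
      (PointedCone.mem_map.2 ⟨a, ha, rfl⟩)))
    rw [map_neg] at h1
    change T a ≤ 0
    linarith
  · have h1 := hTs (-γ) (Submodule.mem_sup_right (Submodule.mem_sup_left
      (Submodule.mem_span_singleton_self _)))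
    rw [map_neg] at h1
    change T γ ≤ 0
    linarith

end Separation

/-! ### Smooth series -/

/-- Smooth compactly supported functions can be summed with suitable positive coefficients. -/
theorem exists_smooth_series {E V : Type*} [NormedAddCommGroup E] [NormedSpace ℝ E]
    [NormedAddCommGroup V] [NormedSpace ℝ V] [CompleteSpace V] (f : ℕ → E → V)
    (hf : ∀ i, ContDiff ℝ ∞ (f i)) (hfc : ∀ i, HasCompactSupport (f i)) :
    ∃ c : ℕ → ℝ, (∀ i, 0 < c i) ∧ Summable c ∧ ∃ F : E → V, ContDiff ℝ ∞ F ∧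
      (∀ y, HasSum (fun i => c i • f i y) (F y)) ∧
      ∀ y, HasSum (fun i => c i • fderiv ℝ (f i) y) (fderiv ℝ F y) := by
  have hB : ∀ i k : ℕ, ∃ B : ℝ, ∀ y, ‖iteratedFDeriv ℝ k (f i) y‖ ≤ B := fun i k =>
    ((hf i).continuous_iteratedFDeriv (m := k)
      (WithTop.coe_le_coe.2 le_top)).bounded_above_of_compact_support
      ((hfc i).iteratedFDeriv k)
  choose B hB using hB
  have hB0 : ∀ i k, 0 ≤ B i k := fun i k => (norm_nonneg _).trans (hB i k 0)
  -- A diagonal choice: `D i` dominates the derivatives of `f i` of orders `k ≤ i`, so for each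
  -- fixed order the weighted bounds are below `2⁻ⁱ` as soon as `i ≥ k`. The summand `1` makes the
  -- weights themselves summable.
  set D : ℕ → ℝ := fun i => 1 + ∑ k ∈ Finset.range (i + 1), B i k
  have hsum0 : ∀ i, 0 ≤ ∑ k ∈ Finset.range (i + 1), B i k := fun i =>
    Finset.sum_nonneg fun k _ => hB0 i k
  have hD : ∀ i, 1 ≤ D i := fun i => le_add_of_nonneg_right (hsum0 i)
  have hD0 : ∀ i, 0 < D i := fun i => one_pos.trans_le (hD i)
  set c : ℕ → ℝ := fun i => (1 / 2) ^ i / D i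
  have hc : ∀ i, 0 < c i := fun i => div_pos (by positivity) (hD0 i)
  have hgeo : Summable fun i : ℕ => (1 / 2 : ℝ) ^ i := summable_geometric_two
  have hcs : Summable c := hgeo.of_nonneg_of_le (fun i => (hc i).le) fun i =>
    div_le_self (by positivity) (hD i)
  set v : ℕ → ℕ → ℝ := fun k i => c i * B i k
  have hv : ∀ k, Summable (v k) := by
    intro k
    refine Summable.of_norm_bounded_eventually_nat hgeo ?_
    filter_upwards [eventually_ge_atTop k] with i hi
    rw [Real.norm_of_nonneg (mul_nonneg (hc i).le (hB0 i k))]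
    have h1 : B i k ≤ D i := by
      have : B i k ≤ ∑ k ∈ Finset.range (i + 1), B i k :=
        Finset.single_le_sum (f := fun k => B i k) (fun k _ => hB0 i k)
          (Finset.mem_range.2 (Nat.lt_succ_of_le hi))
      linarith
    calc c i * B i k ≤ c i * D i := by gcongr; exact (hc i).le
      _ = (1 / 2) ^ i := div_mul_cancel₀ _ (hD0 i).ne'
  have hg : ∀ i, ContDiff ℝ ∞ (fun y => c i • f i y) := fun i => (hf i).const_smul (c i)
  have hgB : ∀ (k i : ℕ) (y : E), ‖iteratedFDeriv ℝ k (fun y => c i • f i y) y‖ ≤ v k i := by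
    intro k i y
    have h1 : iteratedFDeriv ℝ k (fun y => c i • f i y) y = c i • iteratedFDeriv ℝ k (f i) y :=
      iteratedFDeriv_const_smul_apply
        ((hf i).contDiffAt.of_le (WithTop.coe_le_coe.2 le_top))
    rw [h1, norm_smul, Real.norm_of_nonneg (hc i).le]
    exact mul_le_mul_of_nonneg_left (hB i k y) (hc i).le
  have hs0 : ∀ y, Summable fun i => c i • f i y := fun y =>
    Summable.of_norm_bounded (hv 0) fun i => by
      have := hgB 0 i y
      rwa [norm_iteratedFDeriv_zero] at this
  have hB1 : ∀ i y, ‖fderiv ℝ (fun y => c i • f i y) y‖ ≤ v 1 i := fun i y => by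
    have := hgB 1 i y
    rwa [norm_iteratedFDeriv_one] at this
  refine ⟨c, hc, hcs, fun y => ∑' i, c i • f i y, contDiff_tsum (N := ⊤) hg (fun k _ => hv k)
    (fun k i y _ => hgB k i y), fun y => (hs0 y).hasSum, fun y => ?_⟩
  have hd : ∀ i, Differentiable ℝ (fun y => c i • f i y) := fun i =>
    (hg i).differentiable (by simp)
  rw [fderiv_tsum_apply (hv 1) hd hB1 (hs0 0)]
  have h2 : (fun i => c i • fderiv ℝ (f i) y) = fun i => fderiv ℝ (fun y => c i • f i y) y := by
    funext i
    exact (fderiv_const_smul ((hf i).differentiable (by simp) y) (c i)).symm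
  rw [h2]
  exact (Summable.of_norm_bounded (hv 1) fun i => hB1 i y).hasSum

/-! ### Smooth series of differential forms. -/

section Series

variable {E : Type*} [NormedAddCommGroup E] [InnerProductSpace ℝ E] [FiniteDimensional ℝ E] 
  {p : ℕ}

/-- Evaluation at a `p`-vector as a continuous linear functional on forms. -/
def evalCLM (w : ⋀[ℝ]^p E) : (E [⋀^Fin p]→L[ℝ] ℝ) →L[ℝ] ℝ :=
  LinearMap.toContinuousLinearMap
    { toFun := fun a => evalPVector a w
      map_add' := fun a a' => evalPVector_add a a' w
      map_smul' := fun c a => evalPVector_smul c a w }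

theorem evalCLM_apply (w : ⋀[ℝ]^p E) (a : E [⋀^Fin p]→L[ℝ] ℝ) :
    evalCLM w a = evalPVector a w := rfl

theorem evalPVector_ext {V : Type*} [TopologicalSpace V] [AddCommGroup V] [Module ℝ V]
    {a b : V [⋀^Fin p]→L[ℝ] ℝ} (h : ∀ v, evalPVector a v = evalPVector b v) : a = b := by
  ext m
  have := h (exteriorPower.ιMulti ℝ p m)
  simpa [evalPVector] using this

variable {H : Type*} [TopologicalSpace H] {I : ModelWithCorners ℝ E H}
  {M : Type*} [TopologicalSpace M] [ChartedSpace H M] [IsManifold I ∞ M]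

omit [FiniteDimensional ℝ E] in
theorem extChartAt_mem_interior_target {x₀ x : M} (hx : x ∈ (extChartAt I x₀).source)
    (hxi : x ∈ I.interior M) : extChartAt I x₀ x ∈ interior (extChartAt I x₀).target :=
  (I.isInteriorPoint_iff_of_mem_atlas (n := ∞) (by simp) (chart_mem_atlas H x₀)
    (by rwa [extChartAt_source] at hx)).1 hxi

/-- A form supported in a compact set of interior points of a chart extends, in the chart, to a
smooth compactly supported function on the model space. -/
theorem exists_extension_chartRep {x₀ : M} {α : FormField I M p} (hα : SmoothFormOn α univ)
    {T : Set M} (hT : IsCompact T) (hTs : T ⊆ (extChartAt I x₀).source ∩ I.interior M)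
    (h0 : ∀ x ∉ T, α x = 0) :
    ContDiff ℝ ∞ ((extChartAt I x₀).target.indicator (chartRep x₀ α)) ∧
      HasCompactSupport ((extChartAt I x₀).target.indicator (chartRep x₀ α)) := by
  set g := (extChartAt I x₀).target.indicator (chartRep x₀ α)
  have hTc : IsCompact (extChartAt I x₀ '' T) :=
    hT.image_of_continuousOn ((continuousOn_extChartAt x₀).mono fun x hx => (hTs hx).1)
  have hg0 : ∀ y ∉ extChartAt I x₀ '' T, g y = 0 := by
    intro y hy
    by_cases hyt : y ∈ (extChartAt I x₀).target
    · rw [show g y = chartRep x₀ α y from indicator_of_mem hyt _]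
      refine chartRep_eq_zero (h0 _ fun hT' => hy ⟨_, hT', (extChartAt I x₀).right_inv hyt⟩)
    · exact indicator_of_notMem hyt _
  -- At an interior point the chart target is a full neighborhood in `E`, so smoothness within the
  -- range of the model is ordinary smoothness and the extension by zero is harmless.
  refine ⟨contDiff_iff_contDiffAt.2 fun y => ?_, HasCompactSupport.intro hTc hg0⟩
  by_cases hy : y ∈ extChartAt I x₀ '' T
  · obtain ⟨x, hx, rfl⟩ := hy
    have hi := extChartAt_mem_interior_target (hTs hx).1 (hTs hx).2
    have ht : (extChartAt I x₀).target ∈ 𝓝 (extChartAt I x₀ x) := mem_interior_iff_mem_nhds.1 hi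
    have h1 : ContDiffWithinAt ℝ ∞ (chartRep x₀ α) (range I) (extChartAt I x₀ x) :=
      (hα.smoothFormAt isOpen_univ trivial).contDiffWithinAt (mem_of_mem_nhds ht)
    refine (h1.contDiffAt (mem_of_superset ht
      (extChartAt_target_subset_range x₀))).congr_of_eventuallyEq ?_
    filter_upwards [ht] with y hy
    exact indicator_of_mem hy _
  · refine (contDiffAt_const (c := 0)).congr_of_eventuallyEq ?_
    filter_upwards [hTc.isClosed.isOpen_compl.mem_nhds hy] with y' hy'
    exact hg0 y' hy'

omit [FiniteDimensional ℝ E] in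
/-- The exterior derivative at an interior point, in a chart. -/
theorem evalPVector_extD {x₀ x : M} (hx : x ∈ (extChartAt I x₀).source) (hxi : x ∈ I.interior M)
    {α : FormField I M p} (hα : SmoothFormAt α x) {G : E → E [⋀^Fin p]→L[ℝ] ℝ}
    (hG : ∀ᶠ z in 𝓝 x, α z = pullForm x₀ G z) (v : ⋀[ℝ]^(p + 1) (TangentSpace I x)) :
    evalPVector (extD α x) v = evalPVector (ContinuousAlternatingMap.alternatizeUncurryFinCLM ℝ E ℝ
      (fderiv ℝ G (extChartAt I x₀ x))) (chartMap I (p + 1) x₀ x v) := by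
  have hy := (extChartAt I x₀).map_source hx
  have hxy := (extChartAt I x₀).left_inv hx
  have hi : range I ∈ 𝓝 (extChartAt I x₀ x) := mem_of_superset
    (mem_interior_iff_mem_nhds.1 (extChartAt_mem_interior_target hx hxi))
    (extChartAt_target_subset_range x₀)
  rw [evalPVector_eq_chartRep _ hx, chartRep_extD hy (by rwa [hxy])]
  have hG' : ∀ᶠ z in 𝓝 ((extChartAt I x₀).symm (extChartAt I x₀ x)),
      α z = pullForm x₀ G z := by rwa [hxy]
  have h1 : extDerivWithin (chartRep x₀ α) (range I) (extChartAt I x₀ x) =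
      extDerivWithin G (range I) (extChartAt I x₀ x) := by
    refine Filter.EventuallyEq.extDerivWithin_eq ?_ ?_
    · filter_upwards [eventually_target_and hy hG'] with y hy'
      rw [chartRep_congr hy'.2, chartRep_pullForm hy'.1]
    · rw [chartRep_congr hG'.self_of_nhds, chartRep_pullForm hy]
  rw [h1, extDerivWithin, fderivWithin_of_mem_nhds hi]
  rfl

/-- Forms supported in a compact set of interior points can be summed with suitable positive
coefficients; the sum is smooth and the exterior derivative can be computed termwise. -/
theorem exists_form_series [T2Space M] [SecondCountableTopology M] {K : Set M} (hK : IsCompact K)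
    (hKi : K ⊆ I.interior M) (ψ : ℕ → FormField I M p) (hψ : ∀ i, SmoothFormOn (ψ i) univ)
    (hψK : ∀ i, ∀ x ∉ K, ψ i x = 0) :
    ∃ c : ℕ → ℝ, (∀ i, 0 < c i) ∧ Summable c ∧ ∃ Ψ : FormField I M p, SmoothFormOn Ψ univ ∧
      (∀ x ∉ K, Ψ x = 0) ∧ ∀ (x : M) (v : ⋀[ℝ]^(p + 1) (TangentSpace I x)),
        HasSum (fun i => c i * evalPVector (extD (ψ i) x) v) (evalPVector (extD Ψ x) v) := by
  have hint : IsOpen (I.interior M) := I.isOpen_interior (n := ∞) (by simp)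
  have hcut : ∀ x ∈ K, ∃ f : M → ℝ, ContMDiff I 𝓘(ℝ) ∞ f ∧ (∀ᶠ z in 𝓝 x, f z = 1) ∧
      tsupport f ⊆ (extChartAt I x).source ∩ I.interior M ∧ IsCompact (tsupport f) := by
    intro x hx
    obtain ⟨f, hf, hf1, hfW, -, hfc⟩ := exists_cutoff_of_isCompact I
      (isCompact_singleton (x := x)) ((isOpen_extChartAt_source (I := I) x).inter hint)
      (singleton_subset_iff.2 ⟨mem_extChartAt_source x, hKi hx⟩)
    rw [nhdsSet_singleton] at hf1
    exact ⟨f, hf, hf1, hfW, hfc⟩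
  choose! ρ hρ hρ1 hρs hρc using hcut
  set N : M → Set M := fun x => interior {z | ρ x z = 1}
  have hN1 : ∀ x, ∀ z ∈ N x, ∀ᶠ z' in 𝓝 z, ρ x z' = 1 := fun x z hz =>
    mem_interior_iff_mem_nhds.1 hz
  obtain ⟨t, htK, htN⟩ := hK.elim_nhds_subcover N fun x hx =>
    isOpen_interior.mem_nhds (mem_interior_iff_mem_nhds.2 (hρ1 x hx))
  have hNs : ∀ x ∈ K, ∀ z ∈ N x, z ∈ (extChartAt I x).source ∩ I.interior M := by
    intro x hx z hz
    refine hρs x hx (subset_closure ?_)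
    rw [Function.mem_support, (hN1 x z hz).self_of_nhds]
    exact one_ne_zero
  -- The expressions in the finitely many charts are bundled into one vector-valued function, so
  -- that a single sequence of weights serves all charts.
  let f : ℕ → E → (t → E [⋀^Fin p]→L[ℝ] ℝ) := fun i y j =>
    (extChartAt I j.1).target.indicator (chartRep j.1 (mulForm (ρ j.1) (ψ i))) y
  have hext : ∀ (i : ℕ) (j : t), ContDiff ℝ ∞ (fun y => f i y j) ∧
      HasCompactSupport (fun y => f i y j) := fun i j =>
    exists_extension_chartRep ((hψ i).mulForm isOpen_univ (hρ j.1 (htK _ j.2)))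
      (hρc j.1 (htK _ j.2)) (hρs j.1 (htK _ j.2)) fun x hx => by
        change ρ j.1 x • ψ i x = 0
        rw [image_eq_zero_of_notMem_tsupport hx, zero_smul]
  obtain ⟨c, hc, hcs, F, hF, hFs, hFd⟩ := exists_smooth_series f
    (fun i => contDiff_pi.2 fun j => (hext i j).1) (fun i => by
      refine HasCompactSupport.intro (isCompact_iUnion fun j => (hext i j).2) fun y hy => ?_
      funext j
      exact image_eq_zero_of_notMem_tsupport (f := fun y => f i y j) fun h =>
        hy (mem_iUnion.2 ⟨j, h⟩))
  have hψf : ∀ (j : t), ∀ z ∈ N j.1, ∀ i, ψ i z = pullForm j.1 (fun y => f i y j) z := by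
    intro j z hz i
    have hzs := (hNs j.1 (htK _ j.2) z hz).1
    have h1 : f i (extChartAt I j.1 z) j = chartRep j.1 (ψ i) (extChartAt I j.1 z) := by
      change (extChartAt I j.1).target.indicator _ _ = _
      rw [indicator_of_mem ((extChartAt I j.1).map_source hzs), chartRep_mulForm,
        (extChartAt I j.1).left_inv hzs, (hN1 j.1 z hz).self_of_nhds, one_smul]
    rw [form_eq_chartRep (ψ i) hzs, ← h1]
    rfl
  -- The sum is defined pointwise through its values on `p`-vectors, without reference to a chart;
  -- uniqueness of sums makes the local descriptions agree on overlaps.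
  let P : ∀ x : M, (TangentSpace I x [⋀^Fin p]→L[ℝ] ℝ) → Prop := fun x a =>
    ∀ v, HasSum (fun i => c i * evalPVector (ψ i x) v) (evalPVector a v)
  classical
  let Ψ : FormField I M p := fun x => if h : ∃ a, P x a then h.choose else 0
  have hΨ : ∀ (x : M) (a : TangentSpace I x [⋀^Fin p]→L[ℝ] ℝ), P x a → Ψ x = a := by
    intro x a ha
    have h : ∃ a, P x a := ⟨a, ha⟩
    have h1 : Ψ x = h.choose := dif_pos h
    rw [h1]
    exact evalPVector_ext fun v => (h.choose_spec v).unique (ha v)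
  have hΨK : ∀ x ∉ K, Ψ x = 0 := by
    intro x hx
    refine hΨ x 0 fun v => ?_
    simp only [hψK _ x hx, evalPVector_zero, mul_zero]
    exact hasSum_zero
  have hΨN : ∀ (j : t), ∀ z ∈ N j.1, Ψ z = pullForm j.1 (fun y => F y j) z := by
    intro j z hz
    refine hΨ z _ fun v => ?_
    rw [evalPVector_pullForm]
    have h1 := (evalCLM (chartMap I p j.1 z v)).hasSum
      (Pi.hasSum.1 (hFs (extChartAt I j.1 z)) j)
    refine h1.congr_fun fun i => ?_
    rw [hψf j z hz i, evalPVector_pullForm, Pi.smul_apply, map_smul, smul_eq_mul, evalCLM_apply]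
  have hcover : ∀ x ∈ K, ∃ j : t, x ∈ N j.1 := fun x hx => by
    obtain ⟨j, hj, hxj⟩ := mem_iUnion₂.1 (htN hx)
    exact ⟨⟨j, hj⟩, hxj⟩
  have hΨs : SmoothFormOn Ψ univ := by
    refine smoothFormOn_of_smoothFormAt fun x _ => ?_
    by_cases hx : x ∈ K
    · obtain ⟨j, hj⟩ := hcover x hx
      refine (smoothFormAt_pullForm (hNs j.1 (htK _ j.2) x hj).1
        (F := fun y => F y j) (contDiff_pi.1 hF j).contDiffAt.contDiffWithinAt).congr ?_
      filter_upwards [isOpen_interior.mem_nhds hj] with z hz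
      exact hΨN j z hz
    · refine SmoothFormAt.zero_of_eventually ?_
      filter_upwards [hK.isClosed.isOpen_compl.mem_nhds hx] with z hz
      exact hΨK z hz
  refine ⟨c, hc, hcs, Ψ, hΨs, hΨK, fun x v => ?_⟩
  by_cases hx : x ∈ K
  · obtain ⟨j, hj⟩ := hcover x hx
    have hxs := hNs j.1 (htK _ j.2) x hj
    have hev : ∀ᶠ z in 𝓝 x, z ∈ N j.1 := isOpen_interior.mem_nhds hj
    have e1 := evalPVector_extD hxs.1 hxs.2 (hΨs.smoothFormAt isOpen_univ trivial)
      (hev.mono fun z hz => hΨN j z hz) v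
    have e2 := fun i => evalPVector_extD hxs.1 hxs.2 ((hψ i).smoothFormAt isOpen_univ trivial)
      (hev.mono fun z hz => hψf j z hz i) v
    set y := extChartAt I j.1 x
    have hproj : ∀ (g : E → t → E [⋀^Fin p]→L[ℝ] ℝ), DifferentiableAt ℝ g y →
        fderiv ℝ (fun y => g y j) y = (ContinuousLinearMap.proj j).comp (fderiv ℝ g y) :=
      fun g hg => ((hasFDerivAt_pi'.1 hg.hasFDerivAt) j).fderiv
    rw [e1, hproj F (hF.differentiable (by simp) y)]
    -- Selecting the chart component, alternating and evaluating is a continuous linear operation on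
    -- the differential, so it passes through the convergent series of differentials.
    let Λ := (evalCLM (chartMap I (p + 1) j.1 x v)).comp
      ((ContinuousAlternatingMap.alternatizeUncurryFinCLM ℝ E ℝ).comp
        (ContinuousLinearMap.compL ℝ E (t → E [⋀^Fin p]→L[ℝ] ℝ) (E [⋀^Fin p]→L[ℝ] ℝ)
          (ContinuousLinearMap.proj j)))
    refine (Λ.hasSum (hFd y)).congr_fun fun i => ?_
    rw [e2 i, hproj (f i) ((contDiff_pi.2 fun j => (hext i j).1).differentiable (by simp) y),
      map_smul, smul_eq_mul]
    rfl
  · have hz : ∀ α : FormField I M p, (∀ x ∉ K, α x = 0) → extD α x = 0 := by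
      intro α hα
      have : ∀ᶠ z in 𝓝 x, α z = (0 : FormField I M p) z := by
        filter_upwards [hK.isClosed.isOpen_compl.mem_nhds hx] with z hz
        exact hα z hz
      rw [extD_congr this, extD_zero]; rfl
    simp only [hz _ hΨK, hz _ (hψK _), evalPVector_zero, mul_zero]
    exact hasSum_zero

end Series

/-! ### The relative Sullivan theorem -/

section Main

variable {E : Type*} [NormedAddCommGroup E] [InnerProductSpace ℝ E] [FiniteDimensional ℝ E]
  {H : Type*} [TopologicalSpace H] {I : ModelWithCorners ℝ E H}
  {M : Type*} [TopologicalSpace M] [ChartedSpace H M] [IsManifold I ∞ M] [T2Space M]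
  [SecondCountableTopology M] {p : ℕ} {X Z : Set M}

/-- A smooth form can be cut off near a compact set to a test form. -/
theorem exists_testForm_eq {α : FormField I M p} (hα : SmoothFormOn α univ) (hX : IsCompact X) :
    ∃ γ : testForms I M p, ∀ᶠ x in 𝓝ˢ X, γ.1 x = α x := by
  obtain ⟨f, hf, hf1, -, -, hfc⟩ := exists_cutoff_of_isCompact I hX isOpen_univ (subset_univ X)
  refine ⟨⟨mulForm f α, mulForm_mem_testForms isOpen_univ hα hf (subset_univ _) hfc⟩, ?_⟩
  filter_upwards [hf1] with x hx
  change f x • α x = α x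
  rw [hx, one_smul]

/-- A form that is exact near a closed set is cohomologous to a form vanishing near this set. -/
theorem Represents.exists_vanishing {α : FormField I M p} {ξ : DeRham I M p} (hα : Represents α ξ)
    {W A : Set M} (hW : IsOpen W) (hA : IsClosed A) (hAW : A ⊆ W) (hαW : ExactOn α W) :
    ∃ α' : FormField I M p, Represents α' ξ ∧ ∀ᶠ x in 𝓝ˢ A, α' x = 0 := by
  obtain ⟨f, hf, hf1, hfW, -⟩ := exists_cutoff_of_isClosed I hA hW hAW
  obtain ⟨δ, hδ, -, hδα⟩ := hαW.exists_cutoff hW hf hfW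
  refine ⟨α - δ, by simpa using hα.sub hδ, ?_⟩
  filter_upwards [mem_of_superset (isOpen_setOfPred_eventually_nhds.mem_nhdsSet.2
    (eventually_nhdsSet_iff_forall.1 hf1)) subset_rfl] with x hx
  change α x - δ x = 0
  rw [hδα x hx, sub_self]

variable (X) in
theorem exists_isTestRepresentative (hX : IsCompact X) {U : Set M} {ξ : DeRham I M p}
    (hξ : ξ ∈ classesVanishingNear I p (closure U)) : ∃ γ, IsTestRepresentative X U ξ γ := by
  obtain ⟨α, hα, W, hW, hUW, hαW⟩ := hξ
  obtain ⟨α', hα', h0⟩ := hα.exists_vanishing hW isClosed_closure hUW hαW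
  obtain ⟨γ, hγ⟩ := exists_testForm_eq hα'.smooth hX
  exact ⟨γ, α', hα', h0, hγ⟩

variable {S : RelConeStructure I p X Z} {U : Set M} {T : Current I M p}

/-- Structure currents are supported in `X`. -/
theorem RelConeStructure.IsStructureCurrent.eq_zero (hT : S.IsStructureCurrent U T)
    (hX : IsCompact X) (hU : IsOpen U) (hZU : Z ⊆ U) {δ : testForms I M p}
    (hδ : ∀ x ∈ X, δ.1 x = 0) : T.toLinearMap δ = 0 := by
  obtain ⟨θ, hθ, hpos⟩ := S.exists_posOn (hX.diff hU)
    (fun x hx => ⟨hx.1, fun h => hx.2 (hZU h)⟩)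
  have key : ∀ c : ℝ, 0 < T.toLinearMap ⟨θ, hθ⟩ + c * T.toLinearMap δ := by
    intro c
    rw [← smul_eq_mul, ← map_smul, ← map_add]
    refine hT _ fun x hx v hv hv0 => ?_
    change 0 < evalPVector ((θ + c • δ.1) x) v
    rw [evalPVector_form_add, evalPVector_form_smul, hδ x hx.2.1, evalPVector_zero, mul_zero,
      add_zero]
    exact hpos x ⟨⟨hx.2.1, hx.1⟩, hx.2⟩ v hv hv0
  by_contra h
  -- An affine function of `c` that stays positive on all of `ℝ` has slope zero; this `c` would be
  -- its root.
  have h1 := key (-(T.toLinearMap ⟨θ, hθ⟩) / T.toLinearMap δ)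
  rw [div_mul_cancel₀ _ h, add_neg_cancel] at h1
  exact h1.false

/-- On forms that vanish on `Z` and are nonnegative near `U`, a structure cycle is bounded above by
its value on test representatives. -/
theorem RelConeStructure.IsStructureCycle.le_of_isTestRepresentative (hT : S.IsStructureCycle U T)
    (hX : IsCompact X) (hZX : Z ⊆ X) (hU : IsOpen U) (hZU : Z ⊆ U) {ξ : DeRham I M p}
    {α : FormField I M p} (hα : Represents α ξ) (hαZ : ∀ x ∈ Z, α x = 0)
    (hαU : S.NonnegOn α (closure U)) {β γ : testForms I M p} (hβ : ∀ x ∈ X, β.1 x = α x)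
    (hγ : IsTestRepresentative X U ξ γ) : T.toLinearMap β ≤ T.toLinearMap γ := by
  obtain ⟨α', hα', h0, hγα⟩ := hγ
  obtain ⟨f, hf, hf1, -, -, hfc⟩ := exists_cutoff_of_isCompact I hX isOpen_univ (subset_univ X)
  -- `α - α'` need not have compact support; cutting off its primitive gives an exact test form
  -- equal to it on `X`.
  obtain ⟨δ, hδ, hδ0, hδα⟩ := (hα.exactOn_sub hα').exists_cutoff isOpen_univ hf (subset_univ _)
  have hδX : ∀ x ∈ X, δ x = α x - α' x := fun x hx =>
    hδα x (eventually_nhdsSet_iff_forall.1 hf1 x hx)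
  have hα'U : ∀ x ∈ closure U, α' x = 0 := fun x hx =>
    (eventually_nhdsSet_iff_forall.1 h0 x hx).self_of_nhds
  let δ' : testForms I M p :=
    ⟨δ, mem_testForms_of_eq_zero hδ.smooth hfc (isClosed_tsupport f) hδ0⟩
  -- On `closure U` the form `α'` vanishes, so over `X` the difference is just `α` there and
  -- inherits its sign and its zeros on `Z`.
  have h1 : T.toLinearMap δ' ≤ 0 := by
    refine hT.2 δ' ⟨fun x hx => ?_, fun x hx v hv => ?_, hδ⟩
    · change δ x = 0
      rw [hδX x (hZX hx), hαZ x hx, hα'U x (subset_closure (hZU hx)), sub_self]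
    · change 0 ≤ evalPVector (δ x) v
      rw [hδX x hx.2.1, hα'U x hx.1, sub_zero]
      exact hαU x hx v hv
  have h2 : T.toLinearMap (β - γ - δ') = 0 := hT.1.eq_zero hX hU hZU fun x hx => by
    change β.1 x - γ.1 x - δ x = 0
    rw [hβ x hx, hδX x hx, (eventually_nhdsSet_iff_forall.1 hγα x hx).self_of_nhds, sub_self]
  rw [map_sub, map_sub] at h2
  linarith

/-- A representative vanishing near `closure U` satisfies the sign condition trivially, so the
comparison inequality applies in both directions. -/
theorem RelConeStructure.IsStructureCycle.isInducedValue (hT : S.IsStructureCycle U T)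
    (hX : IsCompact X) (hZX : Z ⊆ X) (hU : IsOpen U) (hZU : Z ⊆ U) {ξ : DeRham I M p}
    {γ : testForms I M p} (hγ : IsTestRepresentative X U ξ γ) :
    IsInducedValue X U T ξ (T.toLinearMap γ) := by
  have key : ∀ β γ, IsTestRepresentative X U ξ β → IsTestRepresentative X U ξ γ →
      T.toLinearMap β ≤ T.toLinearMap γ := by
    rintro β γ ⟨α, hα, h0, hβ⟩ hγ
    have hαU : ∀ x ∈ closure U, α x = 0 := fun x hx =>
      (eventually_nhdsSet_iff_forall.1 h0 x hx).self_of_nhds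
    refine hT.le_of_isTestRepresentative hX hZX hU hZU hα
      (fun x hx => hαU x (subset_closure (hZU hx))) (fun x hx v _ => ?_)
      (fun x hx => (eventually_nhdsSet_iff_forall.1 hβ x hx).self_of_nhds) hγ
    rw [hαU x hx.1, evalPVector_zero]
  exact ⟨⟨γ, hγ⟩, fun γ' hγ' => le_antisymm (key _ _ hγ' hγ) (key _ _ hγ hγ')⟩

/-- A class containing a transversal form is positive on structure cycles. -/
theorem RelConeStructure.IsTransversal.positiveOnCycles (hX : IsCompact X) (hZX : Z ⊆ X)
    {ξ : DeRham I M p} {α : FormField I M p} (hα : Represents α ξ) (h : S.IsTransversal α) :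
    S.PositiveOnCycles ξ := by
  intro U hU hZU hξ T hT
  obtain ⟨γ, hγ⟩ := exists_isTestRepresentative X hX hξ
  obtain ⟨β, hβ⟩ := exists_testForm_eq hα.smooth hX
  have hβX : ∀ x ∈ X, β.1 x = α x := fun x hx =>
    (eventually_nhdsSet_iff_forall.1 hβ x hx).self_of_nhds
  refine ⟨_, hT.isInducedValue hX hZX hU hZU hγ, ?_⟩
  refine lt_of_lt_of_le (hT.1 β fun x hx v hv hv0 => ?_)
    (hT.le_of_isTestRepresentative hX hZX hU hZU hα h.2
      (fun x hx => h.1.nonneg x ⟨trivial, hx.2⟩) hβX hγ)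
  rw [hβX x hx.2.1]
  exact h.1 x ⟨trivial, hx.2⟩ v hv hv0

/-- Otherwise separation produces a structure cycle whose induced value on `ξ` is nonpositive. -/
theorem RelConeStructure.PositiveOnCycles.exists_add_mem_openCone {ξ : DeRham I M p}
    (h : S.PositiveOnCycles ξ) (hX : IsCompact X) (hU : IsOpen U) (hZU : Z ⊆ U)
    {γ : testForms I M p} (hγ : IsTestRepresentative X U ξ γ) :
    ∃ a ∈ S.closedCone U 0, γ + a ∈ S.openCone U := by
  by_contra! hn
  obtain ⟨T, hT, hTγ⟩ := S.exists_structureCycle hX hU hZU γ hn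
  have hξ : ξ ∈ classesVanishingNear I p (closure U) := by
    obtain ⟨α, hα, h0, -⟩ := hγ
    obtain ⟨W, hW, hUW, hαW⟩ := eventually_nhdsSet_iff_exists.1 h0
    exact ⟨α, hα, W, hW, hUW, exactOn_of_eq_zero hαW⟩
  obtain ⟨t, ht, htpos⟩ := h U hU hZU hξ T hT
  rw [ht.2 γ hγ] at hTγ
  exact hTγ.not_gt htpos

/-- Countably many local corrections of a form `α` add up to a global correction. -/
theorem RelConeStructure.exists_transversal_add (hX : IsCompact X) (hZX : Z ⊆ X)
    (hXint : X ⊆ I.interior M) {α : FormField I M p} {U : ℕ → Set M} (hZU : ∀ i, Z ⊆ U i)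
    (hαU : ∀ i, ∀ x ∈ closure (U i), α x = 0) (hUZ : ∀ x ∈ X \ Z, ∃ i, x ∉ U i)
    {a : ℕ → testForms I M p} (ha : ∀ i, a i ∈ S.closedCone (U i) 0)
    (hαa : ∀ i, S.PosOn (α + (a i).1) (U i)ᶜ) :
    ∃ δ : FormField I M p, Represents δ (0 : DeRham I M p) ∧
      (∃ K, IsCompact K ∧ ∀ x ∉ K, δ x = 0) ∧ S.IsTransversal (α + δ) := by
  have hαZ : ∀ x ∈ Z, α x = 0 := fun x hx => hαU 0 x (subset_closure (hZU 0 hx))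
  cases p with
  | zero =>
    -- In degree `0` every `a i` is zero, so `α` is already positive off each `U i` and needs no
    -- correction.
    refine ⟨0, ⟨0, rfl, rfl⟩, ⟨∅, isCompact_empty, fun _ _ => rfl⟩,
      fun x hx v hv hv0 => ?_, fun x hx => ?_⟩
    · obtain ⟨i, hi⟩ := hUZ x hx.2
      have h1 := hαa i x ⟨hi, hx.2⟩ v hv hv0
      have h2 : (a i).1 = 0 := funext fun x => (represents_zero_iff.1 (ha i).2.2).2.2 x trivial
      rwa [h2] at h1
    · rw [_root_.add_zero]
      exact hαZ x hx
  | succ p =>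
    have hη : ∀ i, ∃ η : FormField I M p, SmoothFormOn η univ ∧ ∀ x, (a i).1 x = extD η x := by
      intro i
      obtain ⟨η, hη, h⟩ := (represents_zero_iff.1 (ha i).2.2).2.2
      exact ⟨η, hη, fun x => h x trivial⟩
    choose η hη haη using hη
    -- Cutting the primitives off inside the interior leaves `d(f η i) = a i` on `X`, where `f` is
    -- locally `1`, and makes the total correction compactly supported.
    obtain ⟨f, hf, hf1, hfW, -, hfc⟩ := exists_cutoff_of_isCompact I hX
      (I.isOpen_interior (n := ∞) (by simp)) hXint
    obtain ⟨c, hc, hcs, Ψ, hΨ, hΨ0, hsum⟩ := exists_form_series hfc hfW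
      (fun i => mulForm f (η i)) (fun i => (hη i).mulForm_univ isOpen_univ hf (subset_univ _))
      (fun i x hx => by
        change f x • η i x = 0
        rw [image_eq_zero_of_notMem_tsupport hx, zero_smul])
    have hext : ∀ i, ∀ x ∈ X, extD (mulForm f (η i)) x = (a i).1 x := by
      intro i x hx
      rw [haη]
      refine extD_congr ?_
      filter_upwards [eventually_nhdsSet_iff_forall.1 hf1 x hx] with z hz
      change f z • η i z = η i z
      rw [hz, one_smul]
    have hs : 0 < ∑' i, c i := hcs.tsum_pos (fun i => (hc i).le) 0 (hc 0)
    -- Normalizing by the total weight makes `α + δ` on `X` the weighted average of the forms `α + a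
    -- i`: nonnegative termwise, with a positive term at each point of `X \ Z`, and zero on `Z`.
    refine ⟨extD ((∑' i, c i)⁻¹ • Ψ), represents_extD (hΨ.smul _), ⟨tsupport f, hfc,
      fun x hx => ?_⟩, fun x hx v hv hv0 => ?_, fun x hx => ?_⟩
    · have : ∀ᶠ z in 𝓝 x, ((∑' i, c i)⁻¹ • Ψ) z = (0 : FormField I M p) z := by
        filter_upwards [(isClosed_tsupport f).isOpen_compl.mem_nhds hx] with z hz
        change (∑' i, c i)⁻¹ • Ψ z = 0
        rw [hΨ0 z hz, smul_zero]
      rw [extD_congr this, extD_zero]; rfl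
    · have h1 := (hcs.hasSum.mul_right (evalPVector (α x) v)).add (hsum x v)
      simp only [hext _ x hx.2.1, ← mul_add] at h1
      have hnn : ∀ i, 0 ≤ evalPVector (α x) v + evalPVector ((a i).1 x) v := by
        intro i
        by_cases hxi : x ∈ U i
        · rw [hαU i x (subset_closure hxi), evalPVector_zero, zero_add]
          exact (ha i).2.1 x ⟨subset_closure hxi, hx.2⟩ v hv
        · have := hαa i x ⟨hxi, hx.2⟩ v hv hv0
          rw [evalPVector_form_add] at this
          exact this.le
      obtain ⟨i, hi⟩ := hUZ x hx.2
      have hpos := hαa i x ⟨hi, hx.2⟩ v hv hv0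
      rw [evalPVector_form_add] at hpos
      have h2 := h1.summable.tsum_pos (fun i => mul_nonneg (hc i).le (hnn i)) i
        (mul_pos (hc i) hpos)
      rw [h1.tsum_eq] at h2
      rw [evalPVector_form_add, extD_smul, evalPVector_form_smul]
      have h3 := mul_pos (inv_pos.2 hs) h2
      rwa [mul_add, inv_mul_cancel_left₀ hs.ne'] at h3
    · have h0 : extD Ψ x = 0 := evalPVector_ext fun v => by
        refine (hsum x v).unique ?_
        simp only [hext _ x (hZX hx), (ha _).1 x hx, evalPVector_zero, mul_zero]
        exact hasSum_zero
      change α x + extD ((∑' i, c i)⁻¹ • Ψ) x = 0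
      rw [hαZ x hx, extD_smul, zero_add]
      change (∑' i, c i)⁻¹ • extD Ψ x = 0
      rw [h0, smul_zero]

/-- A class that is positive on structure cycles contains a transversal form; this form agrees,
outside of a compact set, with a given representative that is exact near `Z`. -/
theorem RelConeStructure.PositiveOnCycles.exists_isTransversal {ξ : DeRham I M p}
    (h : S.PositiveOnCycles ξ) (hX : IsCompact X) (hZ : IsCompact Z) (hZX : Z ⊆ X)
    (hXint : X ⊆ I.interior M) {α : FormField I M p} (hα : Represents α ξ) {W : Set M}
    (hW : IsOpen W) (hZW : Z ⊆ W) (hαW : ExactOn α W) :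
    ∃ μ : FormField I M p, Represents μ ξ ∧ S.IsTransversal μ ∧
      ∃ K, IsCompact K ∧ ∀ x ∉ K, μ x = α x := by
  obtain ⟨_, _, _⟩ := topology_of_manifold I M
  obtain ⟨f, hf, hf1, hfW, -, hfc⟩ := exists_cutoff_of_isCompact I hZ hW hZW
  obtain ⟨δ, hδ, hδ0, hδα⟩ := hαW.exists_cutoff hW hf hfW
  have hα' : Represents (α - δ) ξ := by simpa using hα.sub hδ
  have hN : Z ⊆ {x | ∀ᶠ z in 𝓝 x, f z = 1} := fun x hx =>
    eventually_nhdsSet_iff_forall.1 hf1 x hx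
  obtain ⟨V, hV, hZV, hVN⟩ := normal_exists_closure_subset hZ.isClosed
    isOpen_setOfPred_eventually_nhds hN
  have hα'N : ∀ x, (∀ᶠ z in 𝓝 x, f z = 1) → (α - δ) x = 0 := fun x hx => by
    change α x - δ x = 0
    rw [hδα x hx, sub_self]
  have := TopologicalSpace.metrizableSpace_of_t3_secondCountable M
  let _ := TopologicalSpace.metrizableSpaceMetric M
  -- A closed set in a metrizable space is a countable intersection of open sets; intersecting these
  -- with `V` gives neighborhoods that shrink to `Z` and whose closures stay where `α - δ` vanishes.
  obtain ⟨G, hG, hZG⟩ := hZ.isClosed.isGδ.eq_iInter_nat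
  have hZU : ∀ i, Z ⊆ V ∩ G i := fun i x hx =>
    ⟨hZV hx, by rw [hZG] at hx; exact mem_iInter.1 hx i⟩
  have hUN : ∀ i, closure (V ∩ G i) ⊆ {x | ∀ᶠ z in 𝓝 x, f z = 1} := fun i =>
    (closure_mono inter_subset_left).trans hVN
  obtain ⟨γ, hγ⟩ := exists_testForm_eq hα'.smooth hX
  have hγX : ∀ x ∈ X, γ.1 x = (α - δ) x := fun x hx =>
    (eventually_nhdsSet_iff_forall.1 hγ x hx).self_of_nhds
  have ha : ∀ i, ∃ a ∈ S.closedCone (V ∩ G i) 0, γ + a ∈ S.openCone (V ∩ G i) := fun i =>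
    h.exists_add_mem_openCone hX (hV.inter (hG i)) (hZU i)
      ⟨α - δ, hα', mem_of_superset (isOpen_setOfPred_eventually_nhds.mem_nhdsSet.2 (hUN i)) hα'N, hγ⟩
  choose a ha ha' using ha
  obtain ⟨δ', hδ', ⟨K, hK, hK0⟩, htr⟩ := RelConeStructure.exists_transversal_add hX hZX hXint hZU
    (fun i x hx => hα'N x (hUN i hx)) (fun x hx => by
      by_contra! hall
      exact hx.2 (by rw [hZG]; exact mem_iInter.2 fun i => (hall i).2)) ha
    (fun i x hx v hv hv0 => by
      have h1 := ha' i x hx v hv hv0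
      change 0 < evalPVector ((γ.1 + (a i).1) x) v at h1
      rw [evalPVector_form_add, hγX x hx.2.1] at h1
      rwa [evalPVector_form_add])
  refine ⟨α - δ + δ', hα'.add_zero hδ', htr, tsupport f ∪ K, hfc.union hK, fun x hx => ?_⟩
  change α x - δ x + δ' x = α x
  rw [hδ0 x fun h => hx (Or.inl h), hK0 x fun h => hx (Or.inr h), sub_zero, _root_.add_zero]

end Main

end RelSullivan

end

theorem mainTheorem2 {E : Type*} [NormedAddCommGroup E] [InnerProductSpace ℝ E]
    [FiniteDimensional ℝ E] {H : Type*} [TopologicalSpace H] (I : ModelWithCorners ℝ E H)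
    {M : Type*} [TopologicalSpace M] [ChartedSpace H M] [IsManifold I ∞ M]
    [T2Space M] [SecondCountableTopology M] (p : ℕ)
    (X Z : Set M) (hX : IsCompact X) (hZ : IsCompact Z) (hZX : Z ⊆ X) (hXint : X ⊆ I.interior M)
    (S : RelSullivan.RelConeStructure I p X Z)
    (ξ : RelSullivan.DeRham I M p) (hξ : ξ ∈ RelSullivan.classesVanishingNear I p Z) :
    ((∃ α : RelSullivan.FormField I M p, RelSullivan.Represents α ξ ∧ S.IsTransversal α) ↔
        S.PositiveOnCycles ξ) ∧
      ((∃ γ : RelSullivan.testForms I M p, RelSullivan.Represents γ.1 ξ) →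
        ((∃ α : RelSullivan.testForms I M p,
            RelSullivan.Represents α.1 ξ ∧ S.IsTransversal α.1) ↔
          S.PositiveOnCycles ξ)) := by
  obtain ⟨α, hα, W, hW, hZW, hαW⟩ := hξ
  refine ⟨⟨fun ⟨β, hβ, hβt⟩ => hβt.positiveOnCycles hX hZX hβ, fun h => ?_⟩,
    fun ⟨γ, hγ⟩ => ⟨fun ⟨β, hβ, hβt⟩ => hβt.positiveOnCycles hX hZX hβ, fun h => ?_⟩⟩
  · obtain ⟨μ, hμ, hμt, -⟩ := h.exists_isTransversal hX hZ hZX hXint hα hW hZW hαW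
    exact ⟨μ, hμ, hμt⟩
  · have hγW : RelSullivan.ExactOn γ.1 W := by
      have h1 := hαW.add hW (hγ.exactOn_sub hα)
      rwa [add_sub_cancel] at h1
    obtain ⟨μ, hμ, hμt, K, hK, hμK⟩ := h.exists_isTransversal hX hZ hZX hXint hγ hW hZW hγW
    refine ⟨⟨μ, RelSullivan.mem_testForms_of_eq_zero hμ.smooth (hK.union γ.2.2)
      (hK.isClosed.union isClosed_closure) fun x hx => ?_⟩, hμ, hμt⟩
    rw [hμK x fun h => hx (Or.inl h)]
    by_contra h0
    exact hx (Or.inr (subset_closure h0))
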